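/- Let $\alpha>0$, let $n$ be the integer with $n-1<\alpha\le n$, and let $1\le p\le 6$. For $f:\mathbb R\to\mathbb R$ the left and right Grünwald–Letnikov derivatives of order $\alpha$ are $$D_{\mp}^{\alpha}f(x)=\lim_{h\to0^+}\frac1{h^\alpha}\sum_{k=0}^\infty(-1)^k\binom{\alpha}{k}f(x\mp kh).$$ Let $w_k$ ($k\ge0$) be the Taylor coefficients at $z=0$ of Lubich's generating function $$W_p(z)=\Big(\sum_{j=1}^p\frac{(1-z)^j}{j}\Big)^{\alpha},$$ and for a real shift $r$ and $h>0$ put $$\Delta_{\mp h,r}^{\alpha}f(x)=\frac1{h^\alpha}\sum_{k=0}^\infty w_k\,f\big(x\mp(k-r)h\big).$$ For real $q\ge 1$ the approximation with shift $r$ is said to be of order $q$ for $f$, on the left (respectively right), if for every $x\in\mathbb R$ the derivative $D^\alpha_{-}f(x)$ (respectively $D^\alpha_{+}f(x)$) exists, the series involved converge for all $h>0$, and $\Delta_{-h,r}^{\alpha}f(x)-D_{-}^{\alpha}f(x)=O(h^q)$ (respectively $\Delta_{+h,r}^{\alpha}f(x)-D_{+}^{\alpha}f(x)=O(h^q)$)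 as $h\to0^+$. 1. (No shift.) If $f\in C^{p+n+1}(\mathbb R)$ and $f^{(k)}\in L^1(\mathbb R)$ for $0\le k\le p+n+1$, then the approximation with shift $r=0$ is of order $p$ for $f$, on the left and on the right. 2. (Nonzero shift.) Let $r\ne0$ be real, and let $f\in C^{n+2}(\mathbb R)$ with $f^{(k)}\in L^1(\mathbb R)$ for $0\le k\le n+2$. Then the approximation with shift $r$ is of order $1$ for $f$, on the left and on the right. If moreover $f\not\equiv0$ and $(p,r)\ne(1,\alpha/2)$, then it is not of order $q$ for $f$ for any real $q>1$, neither on the left nor on the right. -/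

import Mathlib

open Filter Topology Asymptotics

noncomputable section

/-- The left Grünwald type operator with weights `w`, shift `r` and step `h`:
`h ^ (-α) * ∑ₖ w k * f (x - (k - r) h)`. -/
def leftGrunwald (α : ℝ) (w : ℕ → ℝ) (r h : ℝ) (f : ℝ → ℝ) (x : ℝ) : ℝ :=
  1 / h ^ α * ∑' k : ℕ, w k * f (x - ((k : ℝ) - r) * h)

/-- The right Grünwald type operator with weights `w`, shift `r` and step `h`:
`h ^ (-α) * ∑ₖ w k * f (x + (k - r) h)`. -/
def rightGrunwald (α : ℝ) (w : ℕ → ℝ) (r h : ℝ) (f : ℝ → ℝ) (x : ℝ) : ℝ :=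
  1 / h ^ α * ∑' k : ℕ, w k * f (x + ((k : ℝ) - r) * h)

/-- The Grünwald-Letnikov coefficients `(-1) ^ k * binom(α, k)`. -/
def glWeight (α : ℝ) (k : ℕ) : ℝ := (-1) ^ k * Ring.choose α k

/-- `L` is the left Grünwald-Letnikov fractional derivative of order `α` of `f` at `x`:
the defining series converge, and their limit as `h → 0+` is `L`. -/
def HasLeftGLDeriv (α : ℝ) (f : ℝ → ℝ) (x L : ℝ) : Prop :=
  (∀ h : ℝ, 0 < h → Summable fun k : ℕ => glWeight α k * f (x - (k : ℝ) * h)) ∧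
    Tendsto (fun h : ℝ => 1 / h ^ α * ∑' k : ℕ, glWeight α k * f (x - (k : ℝ) * h))
      (𝓝[>] 0) (𝓝 L)

/-- `L` is the right Grünwald-Letnikov fractional derivative of order `α` of `f` at `x`. -/
def HasRightGLDeriv (α : ℝ) (f : ℝ → ℝ) (x L : ℝ) : Prop :=
  (∀ h : ℝ, 0 < h → Summable fun k : ℕ => glWeight α k * f (x + (k : ℝ) * h)) ∧
    Tendsto (fun h : ℝ => 1 / h ^ α * ∑' k : ℕ, glWeight α k * f (x + (k : ℝ) * h))
      (𝓝[>] 0) (𝓝 L)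

/-- The weights `w` approximate the left fractional derivative of order `α` of `f`
with shift `r` and order `q`: at every `x` the derivative exists, the operator is given by
convergent series, and the two differ by `O(h ^ q)` as `h → 0+`. -/
def LeftApproxOrder (α : ℝ) (w : ℕ → ℝ) (r q : ℝ) (f : ℝ → ℝ) : Prop :=
  ∀ x : ℝ, ∃ L : ℝ, HasLeftGLDeriv α f x L ∧
    (∀ h : ℝ, 0 < h → Summable fun k : ℕ => w k * f (x - ((k : ℝ) - r) * h)) ∧
    (fun h : ℝ => leftGrunwald α w r h f x - L) =O[𝓝[>] 0] fun h : ℝ => h ^ q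

/-- The weights `w` approximate the right fractional derivative of order `α` of `f`
with shift `r` and order `q`. -/
def RightApproxOrder (α : ℝ) (w : ℕ → ℝ) (r q : ℝ) (f : ℝ → ℝ) : Prop :=
  ∀ x : ℝ, ∃ L : ℝ, HasRightGLDeriv α f x L ∧
    (∀ h : ℝ, 0 < h → Summable fun k : ℕ => w k * f (x + ((k : ℝ) - r) * h)) ∧
    (fun h : ℝ => rightGrunwald α w r h f x - L) =O[𝓝[>] 0] fun h : ℝ => h ^ q

/-- The Lubich generating function `(∑_{j = 1}^p (1 - z) ^ j / j) ^ α`. -/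
def lubichGen (p : ℕ) (α z : ℝ) : ℝ :=
  (∑ j ∈ Finset.Icc 1 p, (1 - z) ^ j / (j : ℝ)) ^ α

/-- The weights generated by the Lubich function: its Taylor coefficients at `0`
(where the base of the power is positive, so that the function is analytic there). -/
def lubichWeight (p : ℕ) (α : ℝ) (k : ℕ) : ℝ :=
  iteratedDeriv k (lubichGen p α) 0 / (k.factorial : ℝ)

/-- `f` is `N` times continuously differentiable on the line, and all its derivatives of
order `0, …, N` are Lebesgue integrable. -/
def IntegrablySmooth (N : ℕ) (f : ℝ → ℝ) : Prop :=
  ContDiff ℝ N f ∧ ∀ k : ℕ, k ≤ N → MeasureTheory.Integrable (iteratedDeriv k f)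

end

/-! On the Fourier side the Grünwald operator multiplies by h^(-α) σ(hη), where η = 2πξ and σ(θ) =
e^(irθ) W_p(e^(-iθ)), so the order is read off from σ at the origin. The sum ∑_{j≤p} u^j/j truncates
the series of -log(1 - u), which equals z at u = 1 - e^(-z). Hence the base of the Lubich function
at e^(-z) is z + O(z^(p+1)), and without shift σ(θ) = (iθ)^α (1 + O(θ^p))
(`symbolExpansion_lubich_unshifted`). A shift adds the factor e^(rz) and gives (iθ)^α (1 + c iθ +
O(θ²)) with c = r + α · `lubichSecond p` (`symbolExpansion_lubich_shifted`); for r ≠ 0 this c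
vanishes only at (p, r) = (1, α/2). When c ≠ 0, order q > 1 would force the derivative of order α +
1 to vanish at every point, hence the Fourier transform to vanish off the origin, hence f = 0.

Two inputs make this rigorous. The weights must be absolutely summable: W_p is (1 - z)^α times a
power of a cofactor which, for p ≤ 6, maps the closed disc into the slit plane, so both Taylor
series converge absolutely on the circle (`lubichWeight_generating`). And the symbol error, of size
|hη|^(α+s), must be integrable against the transform of f, which decays like |ξ|^(-N); this requires
α + s + 1 < N (`norm_leftGrunwald_sub_le`).

With the available smoothness that inequality holds for α < n but is lost at α = n. There the
weights have finite support, and the symbol expansion becomes moment conditions that feed a Taylor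
expansion of f (`leftGrunwald_sub_isBigO`). `exists_expansion` unites the two cases. The
Grünwald–Letnikov quotient is the case p = 1, r = 0, and the right-sided statements follow by
reflection. -/

noncomputable section

open MeasureTheory
open scoped FourierTransform

/-! ### The cofactor avoids the negative real axis on the closed disc -/

/-- The cofactor of `1 - z` in `∑_{j = 1}^p (1 - z) ^ j / j`. -/
def lubichFactor (p : ℕ) (z : ℂ) : ℂ := ∑ j ∈ Finset.range p, (1 - z) ^ j / ((j : ℂ) + 1)

theorem differentiable_lubichFactor (p : ℕ) : Differentiable ℂ (lubichFactor p) := by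
  unfold lubichFactor; fun_prop

/-- A function holomorphic on the plane with positive real part on the unit circle has positive
real part on the closed unit disc. -/
theorem re_pos_of_re_pos_on_circle {F : ℂ → ℂ} (hF : Differentiable ℂ F)
    (h : ∀ z : ℂ, ‖z‖ = 1 → 0 < (F z).re) {z : ℂ} (hz : ‖z‖ ≤ 1) : 0 < (F z).re := by
  obtain ⟨z₀, hz₀, hmin⟩ := (isCompact_sphere (0 : ℂ) 1).exists_isMinOn
    (NormedSpace.sphere_nonempty.2 zero_le_one)
    (Complex.continuous_re.comp hF.continuous).continuousOn
  have h0 : 0 < (F z₀).re := h z₀ (by simpa using hz₀)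
  -- The minimum principle for the real part is the maximum modulus principle for exp(-F).
  have key : ‖Complex.exp (-F z)‖ ≤ Real.exp (-(F z₀).re) := by
    refine Complex.norm_le_of_forall_mem_frontier_norm_le (U := Metric.ball (0 : ℂ) 1)
      (f := fun z => Complex.exp (-F z))
      Metric.isBounded_ball ?_ ?_ ?_
    · exact (Differentiable.diffContOnCl (by fun_prop))
    · intro w hw
      rw [frontier_ball _ one_ne_zero] at hw
      rw [Complex.norm_exp, Complex.neg_re, Real.exp_le_exp]
      have := hmin hw
      simp only [Function.comp_apply, Set.mem_ofPred_eq] at this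
      linarith
    · rw [closure_ball _ one_ne_zero]; simpa using hz
  rw [Complex.norm_exp, Complex.neg_re, Real.exp_le_exp] at key
  linarith

/-- If `m` and `F * m` have positive real part at a point, then `F` lies in the slit plane. -/
theorem mem_slitPlane_of_re_mul_pos {a m : ℂ} (hm : 0 < m.re) (h : 0 < (a * m).re) :
    a ∈ Complex.slitPlane := by
  rw [Complex.mem_slitPlane_iff]
  by_contra! hc
  rw [Complex.mul_re, hc.2] at h
  nlinarith [hc.1]

/-- On the unit circle z² - 2 Re(z) z + 1 = 0; this is the Chebyshev recurrence, which makes Re(z^k)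
a polynomial in Re z. -/
theorem re_pow_add_two_of_norm_eq_one {z : ℂ} (hz : ‖z‖ = 1) (k : ℕ) :
    (z ^ (k + 2)).re = 2 * z.re * (z ^ (k + 1)).re - (z ^ k).re := by
  have h : z.re * z.re + z.im * z.im = 1 := by
    have := Complex.normSq_eq_norm_sq z
    rw [hz, Complex.normSq_apply] at this
    simpa using this
  simp only [pow_succ, Complex.mul_re, Complex.mul_im]
  linear_combination (-(z ^ k).re) * h

/-- A multiplier 1 + az with 0 ≤ a < 1 has positive real part on the closed disc, so it suffices
that its product with the cofactor does. By the minimum principle this need only be checked on the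
circle, where it is a polynomial inequality in x = Re z on [-1, 1]. -/
theorem lubichFactor_mem_slitPlane {p : ℕ} (hp : 1 ≤ p) (hp' : p ≤ 6) {z : ℂ} (hz : ‖z‖ ≤ 1) :
    lubichFactor p z ∈ Complex.slitPlane := by
  have main : ∃ a : ℝ, 0 ≤ a ∧ a < 1 ∧ ∀ w : ℂ, ‖w‖ = 1 →
      0 < (lubichFactor p w * (1 + a * w)).re := by
    have hre : ∀ w : ℂ, ‖w‖ = 1 → -1 ≤ w.re ∧ w.re ≤ 1 := fun w hw =>
      abs_le.1 (hw ▸ Complex.abs_re_le_norm w)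
    have hr : ∀ w : ℂ, ‖w‖ = 1 → (w ^ 2).re = 2 * w.re ^ 2 - 1 ∧
        (w ^ 3).re = 4 * w.re ^ 3 - 3 * w.re ∧
        (w ^ 4).re = 8 * w.re ^ 4 - 8 * w.re ^ 2 + 1 ∧
        (w ^ 5).re = 16 * w.re ^ 5 - 20 * w.re ^ 3 + 5 * w.re ∧
        (w ^ 6).re = 32 * w.re ^ 6 - 48 * w.re ^ 4 + 18 * w.re ^ 2 - 1 := by
      intro w hw
      have h2 := re_pow_add_two_of_norm_eq_one hw 0
      have h3 := re_pow_add_two_of_norm_eq_one hw 1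
      have h4 := re_pow_add_two_of_norm_eq_one hw 2
      have h5 := re_pow_add_two_of_norm_eq_one hw 3
      have h6 := re_pow_add_two_of_norm_eq_one hw 4
      simp only [zero_add, pow_one, pow_zero, Complex.one_re] at h2 h3 h4 h5 h6
      norm_num at h2 h3 h4 h5 h6
      rw [h2] at h3
      rw [h3, h2] at h4
      rw [h4, h3] at h5
      rw [h5, h4] at h6
      exact ⟨by rw [h2]; ring, by rw [h3]; ring, by rw [h4]; ring, by rw [h5]; ring,
        by rw [h6]; ring⟩
    have hexp : ∀ (c : Fin 7 → ℝ) (w : ℂ), (c 0 + c 1 * w + c 2 * w ^ 2 + c 3 * w ^ 3 + c 4 * w ^ 4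
        + c 5 * w ^ 5 + c 6 * w ^ 6 : ℂ).re = c 0 + c 1 * w.re + c 2 * (w ^ 2).re
        + c 3 * (w ^ 3).re + c 4 * (w ^ 4).re + c 5 * (w ^ 5).re + c 6 * (w ^ 6).re := by
      intro c w
      simp only [Complex.add_re, Complex.re_ofReal_mul, Complex.ofReal_re]
    have hpoly : ∀ (c : Fin 7 → ℝ) (a : ℝ), (∀ w : ℂ, lubichFactor p w * (1 + a * w) =
        c 0 + c 1 * w + c 2 * w ^ 2 + c 3 * w ^ 3 + c 4 * w ^ 4 + c 5 * w ^ 5 + c 6 * w ^ 6) →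
        (∀ x : ℝ, -1 ≤ x → x ≤ 1 → 0 < c 0 + c 1 * x + c 2 * (2 * x ^ 2 - 1)
          + c 3 * (4 * x ^ 3 - 3 * x) + c 4 * (8 * x ^ 4 - 8 * x ^ 2 + 1)
          + c 5 * (16 * x ^ 5 - 20 * x ^ 3 + 5 * x)
          + c 6 * (32 * x ^ 6 - 48 * x ^ 4 + 18 * x ^ 2 - 1)) →
        ∀ w : ℂ, ‖w‖ = 1 → 0 < (lubichFactor p w * (1 + a * w)).re := by
      intro c a h1 h2 w hw
      obtain ⟨e2, e3, e4, e5, e6⟩ := hr w hw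
      rw [h1, hexp, e2, e3, e4, e5, e6]
      exact h2 _ (hre w hw).1 (hre w hw).2
    -- The vectors list the coefficients of the cofactor times 1 + aw. The choice a = 0 suffices for
    -- p ≤ 4; a = 1/2 and a = 3/4 serve p = 5 and p = 6.
    interval_cases p
    · refine ⟨0, le_rfl, one_pos, hpoly ![1, 0, 0, 0, 0, 0, 0] 0 (fun w => ?_) fun x h1 h2 => ?_⟩
      · simp [lubichFactor]
      · simp
    · refine ⟨0, le_rfl, one_pos, hpoly ![3/2, -1/2, 0, 0, 0, 0, 0] 0 (fun w => ?_)
        fun x h1 h2 => ?_⟩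
      · simp [lubichFactor, Finset.sum_range_succ]; ring
      · simp; linarith
    · refine ⟨0, le_rfl, one_pos, hpoly ![11/6, -7/6, 1/3, 0, 0, 0, 0] 0 (fun w => ?_)
        fun x h1 h2 => ?_⟩
      · simp [lubichFactor, Finset.sum_range_succ]; ring
      -- 7/8 is the vertex of the resulting quadratic 2x²/3 - 7x/6 + 3/2.
      · simp; nlinarith [sq_nonneg (x - 7 / 8)]
    · refine ⟨0, le_rfl, one_pos, hpoly ![25/12, -23/12, 13/12, -1/4, 0, 0, 0] 0 (fun w => ?_)
        fun x h1 h2 => ?_⟩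
      · simp [lubichFactor, Finset.sum_range_succ]; ring
      · simp
        nlinarith [mul_nonneg (sub_nonneg.2 h2) (sq_nonneg x), sq_nonneg (x - 7 / 8)]
    · refine ⟨1/2, by norm_num, by norm_num,
        hpoly ![137/60, -63/40, 37/40, 11/120, -13/40, 1/10, 0] (1/2) (fun w => ?_)
        fun x h1 h2 => ?_⟩
      · simp [lubichFactor, Finset.sum_range_succ]; ring
      · have h3 : 0 ≤ 1 + x := by linarith
        have h4 : 0 ≤ x ^ 2 * (1 - x) ^ 2 * (1 + x) := mul_nonneg (by positivity) h3
        simp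
        nlinarith [mul_nonneg (sub_nonneg.2 h2) (sq_nonneg x), sq_nonneg (x - 7 / 8),
          mul_nonneg h3 (sq_nonneg x), mul_nonneg (mul_nonneg (sub_nonneg.2 h2) h3) (sq_nonneg x)]
    · refine ⟨3/4, by norm_num, by norm_num,
        hpoly ![49/20, -137/80, 103/80, 59/240, -241/240, 73/120, -1/8] (3/4) (fun w => ?_)
        fun x h1 h2 => ?_⟩
      · simp [lubichFactor, Finset.sum_range_succ]; ring
      · have h3 : 0 ≤ 1 - x ^ 2 := by nlinarith
        simp
        rcases le_total x 0 with h | h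
        · nlinarith [mul_nonneg (neg_nonneg.2 h) (sq_nonneg x), sq_nonneg (x + 1 / 30),
            sq_nonneg (x ^ 2), sq_nonneg (x ^ 3),
            mul_nonneg (neg_nonneg.2 h) (mul_nonneg h3 (sq_nonneg x)),
            mul_nonneg (mul_nonneg h3 (sq_nonneg x)) (sq_nonneg x), mul_nonneg h3 (sq_nonneg x)]
        · nlinarith [mul_nonneg h (sq_nonneg (x - 4 / 5)),
            mul_nonneg h (mul_nonneg h3 (sq_nonneg (x - 4 / 5))), sq_nonneg (x ^ 2),
            sq_nonneg (x * (x - 4 / 5)), mul_nonneg h3 (sq_nonneg (x * (x - 4 / 5))),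
            mul_nonneg h (sq_nonneg (x * (x - 4 / 5))), mul_nonneg (mul_nonneg h h3) (sq_nonneg x),
            mul_nonneg h3 (sq_nonneg x)]
  obtain ⟨a, ha0, ha1, ha⟩ := main
  have hmul := re_pos_of_re_pos_on_circle (F := fun w => lubichFactor p w * (1 + a * w))
    ((differentiable_lubichFactor p).mul (by fun_prop)) ha hz
  refine mem_slitPlane_of_re_mul_pos ?_ hmul
  have h1 : -1 ≤ z.re := (abs_le.1 ((Complex.abs_re_le_norm z).trans hz)).1
  simp only [Complex.add_re, Complex.one_re, Complex.re_ofReal_mul]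
  nlinarith

/-! ### Absolute summability and generating functions of the weights -/

theorem glWeight_succ (α : ℝ) (k : ℕ) :
    glWeight α (k + 1) = (-1) ^ (k + 1) * Ring.choose (α - 1) (k + 1)
      - (-1) ^ k * Ring.choose (α - 1) k := by
  have := Ring.choose_succ_succ (α - 1) k
  rw [sub_add_cancel] at this
  rw [glWeight, this]; ring

theorem ring_choose_succ_mul (a : ℝ) (k : ℕ) :
    Ring.choose a (k + 1) * (k + 1) = Ring.choose a k * (a - k) := by
  have := Ring.choose_smul_choose a (Nat.le_succ k)
  simp only [Nat.succ_eq_add_one, Nat.choose_succ_self_right, nsmul_eq_mul, Nat.cast_add,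
    Nat.cast_one, add_tsub_cancel_left, Ring.choose_one_right] at this
  linarith

/-- The Grünwald-Letnikov coefficients of positive order are absolutely summable. -/
theorem summable_norm_glWeight {α : ℝ} (hα : 0 < α) : Summable fun k => ‖glWeight α k‖ := by
  obtain ⟨K, hK⟩ := exists_nat_ge α
  set s : ℕ → ℝ := fun k => |Ring.choose (α - 1) k| with hs
  -- For k ≥ α the numbers `Ring.choose (α - 1) k` alternate in sign and do not grow in absolute
  -- value, so Pascal's rule makes each weight the drop between consecutive absolute values, and the
  -- sums telescope.
  have hstep : ∀ k, K ≤ k → ‖glWeight α (k + 1)‖ = s k - s (k + 1) := by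
    intro k hk
    have hk' : α ≤ k := hK.trans (by exact_mod_cast hk)
    have hpos : (0 : ℝ) < k + 1 := by positivity
    have h1 : Ring.choose (α - 1) (k + 1) = -((k + 1 - α) / (k + 1) * Ring.choose (α - 1) k) := by
      have := ring_choose_succ_mul (α - 1) k
      field_simp
      linarith
    have h2 : glWeight α (k + 1) = (-1) ^ (k + 1) * (α / (k + 1) * Ring.choose (α - 1) k) := by
      rw [glWeight_succ, h1]; field_simp; ring
    have h3 : 0 ≤ (k + 1 - α) / (k + 1) := div_nonneg (by linarith) hpos.le
    rw [h2, hs, Real.norm_eq_abs]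
    simp only [h1, abs_neg, abs_mul, abs_pow, abs_one, one_pow, one_mul]
    rw [abs_of_nonneg h3, abs_of_pos (div_pos hα hpos)]
    field_simp; ring
  rw [← summable_nat_add_iff (K + 1)]
  refine summable_of_sum_range_le (c := s K) (fun _ => norm_nonneg _) fun N => ?_
  have : ∀ N, ∑ i ∈ Finset.range N, ‖glWeight α (i + (K + 1))‖ = s K - s (N + K) := by
    intro N
    induction N with
    | zero => simp
    | succ N ih =>
      rw [Finset.sum_range_succ, ih, ← add_assoc, hstep (N + K) (by omega),
        add_right_comm N 1 K]
      ring
  rw [this]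
  linarith [abs_nonneg (Ring.choose (α - 1) (N + K))]

theorem continuousOn_tsum_mul_pow {w : ℕ → ℂ} (hw : Summable fun k => ‖w k‖) :
    ContinuousOn (fun z : ℂ => ∑' k, w k * z ^ k) (Metric.closedBall 0 1) := by
  refine continuousOn_tsum (fun k => by fun_prop) hw fun k z hz => ?_
  rw [norm_mul, norm_pow]
  exact mul_le_of_le_one_right (norm_nonneg _)
    (pow_le_one₀ (norm_nonneg _) (by simpa using hz))

/-- The binomial series of `(1 - z) ^ α` on the closed unit disc. -/
theorem tsum_glWeight_mul_pow {α : ℝ} (hα : 0 < α) {z : ℂ} (hz : ‖z‖ ≤ 1) :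
    ∑' k, (glWeight α k : ℂ) * z ^ k = (1 - z) ^ (α : ℂ) := by
  have hopen : Set.EqOn (fun z : ℂ => ∑' k, (glWeight α k : ℂ) * z ^ k)
      (fun z => (1 - z) ^ (α : ℂ)) (Metric.ball 0 1) := by
    intro z hz
    have h := (Complex.one_add_cpow_hasFPowerSeriesOnBall_zero (a := (α : ℂ))).hasSum (y := -z)
      (by simpa [← ENNReal.ofReal_one, Metric.eball_ofReal] using hz)
    simp only [binomialSeries_apply, List.ofFn_const, List.prod_replicate, smul_eq_mul, zero_add]
      at h
    rw [← sub_eq_add_neg] at h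
    refine Eq.trans ?_ h.tsum_eq
    refine tsum_congr fun k => ?_
    rw [glWeight, neg_pow z]
    push_cast [Complex.ofReal_choose]
    ring
  -- The identity passes from the open disc to its closure by continuity; at z = 1 continuity of the
  -- power uses α > 0.
  refine hopen.of_subset_closure (t := Metric.closedBall 0 1) ?_ ?_ Metric.ball_subset_closedBall
    (by rw [closure_ball _ one_ne_zero]) (by simpa using hz)
  · refine continuousOn_tsum_mul_pow (w := fun k => (glWeight α k : ℂ)) ?_
    simpa only [Complex.norm_real] using summable_norm_glWeight hα
  · intro w hw
    refine ContinuousAt.continuousWithinAt ?_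
    refine ContinuousAt.comp (f := fun z : ℂ => 1 - z) (g := fun z : ℂ => z ^ (α : ℂ)) ?_
      (by fun_prop)
    refine Complex.continuousAt_cpow_const_of_re_pos (Or.inl ?_) (by simpa using hα)
    have := (Complex.re_le_norm w).trans (by simpa using hw : ‖w‖ ≤ 1)
    simp only [Complex.sub_re, Complex.one_re]
    linarith

/-- The Taylor coefficients of `g ^ α` are absolutely summable when `g` is an entire function
mapping the closed unit disc to the slit plane. -/
theorem exists_summable_taylor_cpow {g : ℂ → ℂ} (hg : Differentiable ℂ g)
    (hs : ∀ z : ℂ, ‖z‖ ≤ 1 → g z ∈ Complex.slitPlane) (a : ℂ) :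
    ∃ b : ℕ → ℂ, (Summable fun k => ‖b k‖) ∧
      ∀ z : ℂ, ‖z‖ ≤ 1 → ∑' k, b k * z ^ k = g z ^ a := by
  -- By compactness g maps a disc of radius 1 + δ into the slit plane, so the Taylor series of g ^ a
  -- converges absolutely at z = 1.
  obtain ⟨δ, hδ, hsub⟩ := (isCompact_closedBall (0 : ℂ) 1).exists_cthickening_subset_open
    (Complex.isOpen_slitPlane.preimage hg.continuous) (fun z hz => hs z (by simpa using hz))
  have hball : Metric.ball (0 : ℂ) (1 + δ) ⊆ g ⁻¹' Complex.slitPlane := by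
    refine subset_trans ?_ hsub
    rw [cthickening_closedBall hδ.le zero_le_one, add_comm]
    exact Metric.ball_subset_closedBall
  have hd : DifferentiableOn ℂ (fun z => g z ^ a) (Metric.ball 0 (1 + δ)) := fun z hz =>
    ((hg z).cpow_const (hball hz)).differentiableWithinAt
  have hsum := fun z hz => Complex.hasSum_taylorSeries_on_ball hd (z := z) hz
  simp only [sub_zero] at hsum
  refine ⟨fun k => ((k.factorial : ℂ))⁻¹ * iteratedDeriv k (fun z => g z ^ a) 0, ?_, ?_⟩
  · have := (hsum 1 (by simp [hδ])).summable.norm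
    simpa using this
  · intro z hz
    rw [← (hsum z (by simp; linarith)).tsum_eq]
    refine tsum_congr fun k => ?_
    simp only [smul_eq_mul]; ring

/-- A complex power series representing a real analytic function on the real line has the Taylor
coefficients of that function. -/
theorem eq_taylor_of_hasSum {f : ℝ → ℝ} (hf : AnalyticAt ℝ f 0) {c : ℕ → ℂ}
    (hc : ∀ᶠ x : ℝ in 𝓝 0, HasSum (fun k => c k * (x : ℂ) ^ k) (f x : ℂ)) (k : ℕ) :
    c k = ((iteratedDeriv k f 0 / k.factorial : ℝ) : ℂ) := by
  have h2 := (hasFPowerSeriesAt_iff.1 hf.hasFPowerSeriesAt)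
  let P : (ℕ → ℂ) → FormalMultilinearSeries ℝ ℝ ℂ :=
    fun d k => ContinuousMultilinearMap.mkPiRing ℝ (Fin k) (d k)
  have key : ∀ d : ℕ → ℂ, (∀ᶠ x : ℝ in 𝓝 0, HasSum (fun k => d k * (x : ℂ) ^ k) (f x : ℂ)) →
      HasFPowerSeriesAt (fun x : ℝ => (f x : ℂ)) (P d) 0 := by
    intro d hd
    refine hasFPowerSeriesAt_iff.2 ?_
    filter_upwards [hd] with x hx
    rw [zero_add]
    convert! hx using 2 with k
    rw [FormalMultilinearSeries.coeff, ContinuousMultilinearMap.mkPiRing_apply]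
    simp [mul_comm]
  have h3 := (key c hc).eq_formalMultilinearSeries
    (key (fun k => ((iteratedDeriv k f 0 / k.factorial : ℝ) : ℂ)) ?_)
  · have := congrFun h3 k
    exact (ContinuousMultilinearMap.mkPiRing_eq_iff).1 this
  · filter_upwards [h2] with x hx
    have := Complex.hasSum_ofReal.2 hx
    rw [zero_add] at this
    convert! this using 2 with k
    simp [mul_comm]

theorem lubich_sum_eq_mul_factor (p : ℕ) (z : ℂ) :
    ∑ j ∈ Finset.Icc 1 p, (1 - z) ^ j / (j : ℂ) = (1 - z) * lubichFactor p z := by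
  induction p with
  | zero => simp [lubichFactor]
  | succ p ih =>
    rw [Finset.sum_Icc_succ_top (by omega), ih, lubichFactor, lubichFactor,
      Finset.sum_range_succ]
    push_cast
    ring

theorem lubichGen_base_pos {p : ℕ} (hp : 1 ≤ p) {x : ℝ} (hx : x < 1) :
    0 < ∑ j ∈ Finset.Icc 1 p, (1 - x) ^ j / (j : ℝ) := by
  refine Finset.sum_pos (fun j hj => ?_) ⟨1, by simpa using hp⟩
  have : 0 < j := (Finset.mem_Icc.1 hj).1
  have : 0 < 1 - x := by linarith
  positivity

theorem analyticAt_lubichGen {p : ℕ} (hp : 1 ≤ p) (α : ℝ) : AnalyticAt ℝ (lubichGen p α) 0 := by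
  unfold lubichGen
  have h : AnalyticAt ℝ (fun z : ℝ => ∑ j ∈ Finset.Icc 1 p, (1 - z) ^ j / (j : ℝ)) 0 := by
    fun_prop
  exact (h.contDiffAt.rpow_const_of_ne (n := ⊤) (lubichGen_base_pos hp one_pos).ne').analyticAt

/-- The Lubich weights are absolutely summable, and on the closed unit disc they sum to the
boundary values of the Lubich function. -/
theorem lubichWeight_generating {α : ℝ} (hα : 0 < α) {p : ℕ} (hp : 1 ≤ p) (hp' : p ≤ 6) :
    (Summable fun k => ‖lubichWeight p α k‖) ∧ ∀ z : ℂ, ‖z‖ ≤ 1 →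
      ∑' k, (lubichWeight p α k : ℂ) * z ^ k
        = (1 - z) ^ (α : ℂ) * lubichFactor p z ^ (α : ℂ) := by
  obtain ⟨b, hb, hbz⟩ := exists_summable_taylor_cpow (differentiable_lubichFactor p)
    (fun z hz => lubichFactor_mem_slitPlane hp hp' hz) (α : ℂ)
  set a : ℕ → ℂ := fun k => (glWeight α k : ℂ) with ha
  have han : Summable fun k => ‖a k‖ := by
    simpa only [ha, Complex.norm_real] using summable_norm_glWeight hα
  -- The Cauchy product of the binomial series with the series of the cofactor's power.
  set c : ℕ → ℂ := fun k => ∑ kl ∈ Finset.HasAntidiagonal.antidiagonal k, a kl.1 * b kl.2 with hc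
  have hcn : Summable fun k => ‖c k‖ := summable_norm_sum_mul_antidiagonal_of_summable_norm han hb
  have hz_norm : ∀ {d : ℕ → ℂ}, (Summable fun k => ‖d k‖) → ∀ z : ℂ, ‖z‖ ≤ 1 →
      Summable fun k => ‖d k * z ^ k‖ := by
    intro d hd z hz
    refine hd.of_nonneg_of_le (fun _ => norm_nonneg _) fun k => ?_
    rw [norm_mul, norm_pow]
    exact mul_le_of_le_one_right (norm_nonneg _) (pow_le_one₀ (norm_nonneg _) hz)
  have hcz : ∀ z : ℂ, ‖z‖ ≤ 1 →
      ∑' k, c k * z ^ k = (1 - z) ^ (α : ℂ) * lubichFactor p z ^ (α : ℂ) := by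
    intro z hz
    rw [← hbz z hz, ← tsum_glWeight_mul_pow hα hz,
      tsum_mul_tsum_eq_tsum_sum_antidiagonal_of_summable_norm (hz_norm han z hz) (hz_norm hb z hz)]
    refine tsum_congr fun k => ?_
    rw [hc, Finset.sum_mul]
    refine Finset.sum_congr rfl fun kl hkl => ?_
    rw [← Finset.HasAntidiagonal.mem_antidiagonal.1 hkl, pow_add]
    ring
  -- The coefficients are identified on the real interval (-1, 1), where both bases are nonnegative
  -- and the power of the product splits without branch issues.
  have hcw : ∀ k, c k = (lubichWeight p α k : ℂ) := by
    refine eq_taylor_of_hasSum (analyticAt_lubichGen hp α) ?_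
    filter_upwards [Metric.ball_mem_nhds (0 : ℝ) one_pos] with x hx
    have hx1 : |x| < 1 := by simpa using hx
    have hxn : ‖(x : ℂ)‖ ≤ 1 := by simpa using hx1.le
    have hs := (hz_norm hcn x hxn).of_norm.hasSum
    rw [hcz x hxn] at hs
    refine Eq.subst (motive := fun v => HasSum _ v) ?_ hs
    have hx0 : 0 ≤ 1 - x := by linarith [(abs_lt.1 hx1).2]
    have hfac : lubichFactor p x = ((∑ j ∈ Finset.range p, (1 - x) ^ j / ((j : ℝ) + 1) : ℝ) : ℂ) := by
      rw [lubichFactor]; push_cast; rfl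
    have hsum : ∑ j ∈ Finset.Icc 1 p, (1 - x) ^ j / (j : ℝ)
        = (1 - x) * ∑ j ∈ Finset.range p, (1 - x) ^ j / ((j : ℝ) + 1) := by
      have := lubich_sum_eq_mul_factor p (x : ℂ)
      rw [hfac] at this
      exact_mod_cast this
    have hf0 : 0 ≤ ∑ j ∈ Finset.range p, (1 - x) ^ j / ((j : ℝ) + 1) :=
      Finset.sum_nonneg fun j _ => by positivity
    rw [hfac, lubichGen, hsum, Real.mul_rpow hx0 hf0, Complex.ofReal_mul,
      Complex.ofReal_cpow hx0, Complex.ofReal_cpow hf0]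
    push_cast
    rfl
  refine ⟨?_, fun z hz => by simpa only [hcw] using hcz z hz⟩
  simpa only [hcw, Complex.norm_real] using hcn

/-- Makes the Grünwald–Letnikov quotient itself a Lubich operator, so that its limit comes from the
same symbol expansion. -/
theorem glWeight_eq_lubichWeight {α : ℝ} (hα : 0 < α) (k : ℕ) :
    glWeight α k = lubichWeight 1 α k := by
  have h := eq_taylor_of_hasSum (analyticAt_lubichGen le_rfl α)
    (c := fun k => (glWeight α k : ℂ)) ?_ k
  · exact_mod_cast h
  filter_upwards [Metric.ball_mem_nhds (0 : ℝ) one_pos] with x hx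
  have hx1 : |x| < 1 := by simpa using hx
  have hxn : ‖(x : ℂ)‖ ≤ 1 := by simpa using hx1.le
  have hsum : Summable fun k => (glWeight α k : ℂ) * (x : ℂ) ^ k := by
    refine Summable.of_norm ((summable_norm_glWeight hα).of_nonneg_of_le
      (fun _ => norm_nonneg _) fun k => ?_)
    rw [norm_mul, norm_pow, Complex.norm_real]
    exact mul_le_of_le_one_right (norm_nonneg _) (pow_le_one₀ (norm_nonneg _) hxn)
  refine Eq.subst (motive := fun v => HasSum _ v) ?_ hsum.hasSum
  rw [tsum_glWeight_mul_pow hα hxn, lubichGen]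
  have hx0 : 0 ≤ 1 - x := by linarith [(abs_lt.1 hx1).2]
  simp [Complex.ofReal_cpow hx0]

/-! ### Expansion of the symbol at the origin -/

/-- The Lubich polynomial evaluated at `exp (-z)`. -/
def lubichExp (p : ℕ) (z : ℂ) : ℂ :=
  (1 - Complex.exp (-z)) * lubichFactor p (Complex.exp (-z))

theorem exp_neg_sub_one_isBigO :
    (fun z : ℂ => Complex.exp (-z) - 1) =O[𝓝 0] fun z => z := by
  have h := (Complex.exp_sub_sum_range_isBigO_pow 1).comp_tendsto
    (show Tendsto (fun z : ℂ => -z) (𝓝 0) (𝓝 0) by simpa using (continuous_neg (G := ℂ)).tendsto 0)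
  have h2 : _ =O[𝓝 0] fun z : ℂ => z := h.trans (IsBigO.of_bound 1 (by simp))
  simpa [Function.comp_def] using h2

theorem tendsto_exp_neg_sub_one :
    Tendsto (fun z : ℂ => Complex.exp (-z) - 1) (𝓝 0) (𝓝 0) := by
  have : Continuous fun z : ℂ => Complex.exp (-z) - 1 := by fun_prop
  simpa using this.tendsto 0

/-- The Lubich sum is the Taylor polynomial of degree p of -log(1 - u) at u = 1 - e^(-z), and for
small z this logarithm is exactly z. -/
theorem lubichExp_sub_isBigO (p : ℕ) :
    (fun z : ℂ => lubichExp p z - z) =O[𝓝 0] fun z => z ^ (p + 1) := by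
  have h1 := (Complex.log_sub_logTaylor_isBigO p).comp_tendsto tendsto_exp_neg_sub_one
  have h2 := h1.trans (exp_neg_sub_one_isBigO.pow (p + 1))
  refine h2.congr' ?_ EventuallyEq.rfl
  filter_upwards [Metric.ball_mem_nhds (0 : ℂ) one_pos] with z hz
  have hz1 : |z.im| < 1 := (Complex.abs_im_le_norm z).trans_lt (by simpa using hz)
  have hpi := Real.pi_gt_three
  have hlog : Complex.log (1 + (Complex.exp (-z) - 1)) = -z := by
    rw [add_sub_cancel, Complex.log_exp]
    · rw [Complex.neg_im]; linarith [(abs_lt.1 hz1).2]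
    · rw [Complex.neg_im]; linarith [(abs_lt.1 hz1).1]
  simp only [Function.comp_apply]
  rw [hlog, lubichExp, ← lubich_sum_eq_mul_factor, Complex.logTaylor,
    Finset.range_eq_Ico, Finset.sum_eq_sum_Ico_succ_bot (by omega)]
  have : Finset.Ico (0 + 1) (p + 1) = Finset.Icc 1 p := by ext; simp only [Finset.mem_Ico, Finset.mem_Icc]; omega
  rw [this]
  have hs : ∑ j ∈ Finset.Icc 1 p, (-1 : ℂ) ^ (j + 1) * (Complex.exp (-z) - 1) ^ j / j
      = -∑ j ∈ Finset.Icc 1 p, (1 - Complex.exp (-z)) ^ j / (j : ℂ) := by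
    rw [← Finset.sum_neg_distrib]
    refine Finset.sum_congr rfl fun j _ => ?_
    rw [← neg_sub (1 : ℂ), neg_pow (1 - Complex.exp (-z)), pow_succ]
    have : (-1 : ℂ) ^ j * (-1) ^ j = 1 := by rw [← mul_pow]; simp
    linear_combination (-(1 - Complex.exp (-z)) ^ j / (j : ℂ)) * this
  rw [hs]
  simp
  ring

/-- The coefficient of `z ^ 2` in the expansion of `lubichExp p`. -/
def lubichSecond (p : ℕ) : ℝ := if p = 1 then -1 / 2 else 0

theorem lubichExp_second_order {p : ℕ} (hp : 1 ≤ p) :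
    (fun z : ℂ => lubichExp p z - z * (1 + lubichSecond p * z)) =O[𝓝 0] fun z => z ^ 3 := by
  rcases eq_or_lt_of_le hp with rfl | hp2
  · have h := (Complex.exp_sub_sum_range_isBigO_pow 3).comp_tendsto
      (show Tendsto (fun z : ℂ => -z) (𝓝 0) (𝓝 0) by
        simpa using (continuous_neg (G := ℂ)).tendsto 0)
    have h2 : _ =O[𝓝 0] fun z : ℂ => z ^ 3 := h.neg_left.trans (IsBigO.of_bound 1 (by simp))
    refine h2.congr' (Eventually.of_forall fun z => ?_) EventuallyEq.rfl
    simp [lubichExp, lubichFactor, lubichSecond, Finset.sum_range_succ]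
    ring
  · have h0 : (fun z : ℂ => z ^ (p + 1)) =O[𝓝 0] fun z => z ^ 3 := by
      refine IsBigO.of_bound 1 ?_
      filter_upwards [Metric.ball_mem_nhds (0 : ℂ) one_pos] with z hz
      rw [norm_pow, norm_pow, one_mul]
      exact pow_le_pow_of_le_one (norm_nonneg _) (by simpa using (Metric.mem_ball.1 hz).le)
        (by omega)
    have h := (lubichExp_sub_isBigO p).trans h0
    simpa [lubichSecond, hp2.ne'] using h

theorem one_add_cpow_isBigO (a : ℂ) :
    (fun v : ℂ => (1 + v) ^ a - 1) =O[𝓝 0] fun v => v := by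
  have h := (Complex.one_add_cpow_hasFPowerSeriesAt_zero (a := a)).isBigO_sub_partialSum_pow 1
  refine (h.congr_left fun v => ?_).trans (IsBigO.of_bound 1 (by simp))
  simp [FormalMultilinearSeries.partialSum, -FormalMultilinearSeries.apply_eq_prod_smul_coeff]

theorem one_add_cpow_second_order (a : ℂ) :
    (fun v : ℂ => (1 + v) ^ a - 1 - a * v) =O[𝓝 0] fun v => v ^ 2 := by
  have h := (Complex.one_add_cpow_hasFPowerSeriesAt_zero (a := a)).isBigO_sub_partialSum_pow 2
  refine (h.congr_left fun v => ?_).trans (IsBigO.of_bound 1 (by simp))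
  simp [FormalMultilinearSeries.partialSum, Finset.sum_range_succ,
    -FormalMultilinearSeries.apply_eq_prod_smul_coeff]
  ring

theorem lubichFactor_one {p : ℕ} (hp : 1 ≤ p) : lubichFactor p 1 = 1 := by
  obtain ⟨q, rfl⟩ := Nat.exists_eq_add_of_le' hp
  simp [lubichFactor, Finset.sum_range_succ']

theorem mul_cpow_of_ne_zero {a b : ℂ} (ha : a ≠ 0) (hb : b ≠ 0)
    (h : a.arg + b.arg ∈ Set.Ioc (-Real.pi) Real.pi) (s : ℂ) :
    (a * b) ^ s = a ^ s * b ^ s := by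
  rw [Complex.cpow_def_of_ne_zero (mul_ne_zero ha hb), Complex.cpow_def_of_ne_zero ha,
    Complex.cpow_def_of_ne_zero hb, Complex.log_mul ha hb h, add_mul, Complex.exp_add]

/-- The two arguments are at most π/2 in absolute value, the second strictly less, so their sum
stays inside (-π, π) and the principal branch does not wrap. -/
theorem mul_cpow_of_re {a b : ℂ} (ha : a ≠ 0) (ha' : 0 ≤ a.re) (hb : 0 < b.re) (s : ℂ) :
    (a * b) ^ s = a ^ s * b ^ s := by
  have hb0 : b ≠ 0 := by rintro rfl; simp at hb
  refine mul_cpow_of_ne_zero ha hb0 ?_ s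
  have h1 := abs_le.1 (Complex.abs_arg_le_pi_div_two_iff.2 ha')
  have h2 := abs_lt.1 (Complex.abs_arg_lt_pi_div_two_iff.2 (Or.inl hb))
  exact ⟨by linarith, by linarith⟩

theorem lubichExp_div_sub_one_isBigO (p : ℕ) :
    (fun z : ℂ => lubichExp p z / z - 1) =O[𝓝[≠] 0] fun z => z ^ p := by
  have h := ((lubichExp_sub_isBigO p).mono nhdsWithin_le_nhds).mul
    (isBigO_refl (fun z : ℂ => z⁻¹) (𝓝[≠] 0))
  refine h.congr' ?_ ?_ <;> filter_upwards [self_mem_nhdsWithin] with z hz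
  · have : z ≠ 0 := hz
    field_simp
  · have : z ≠ 0 := hz
    field_simp
    ring

theorem lubichExp_div_second_order {p : ℕ} (hp : 1 ≤ p) :
    (fun z : ℂ => lubichExp p z / z - 1 - lubichSecond p * z) =O[𝓝[≠] 0] fun z => z ^ 2 := by
  have h := ((lubichExp_second_order hp).mono nhdsWithin_le_nhds).mul
    (isBigO_refl (fun z : ℂ => z⁻¹) (𝓝[≠] 0))
  refine h.congr' ?_ ?_ <;> filter_upwards [self_mem_nhdsWithin] with z hz
  · have : z ≠ 0 := hz
    field_simp
    ring
  · have : z ≠ 0 := hz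
    field_simp

theorem tendsto_lubichExp_div {p : ℕ} (hp : 1 ≤ p) :
    Tendsto (fun z : ℂ => lubichExp p z / z - 1) (𝓝[≠] 0) (𝓝 0) := by
  refine (lubichExp_div_sub_one_isBigO p).trans_tendsto ?_
  have : Continuous fun z : ℂ => z ^ p := by fun_prop
  have h := (this.tendsto 0).mono_left (nhdsWithin_le_nhds (s := {0}ᶜ))
  rwa [zero_pow (by omega)] at h

/-- Near the origin, the boundary values of the Lubich function on the unit circle are the
principal power of `z` times a power of a number close to one. -/
theorem lubich_boundary_eq {p : ℕ} (hp : 1 ≤ p) (s : ℂ) :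
    ∀ᶠ z : ℂ in 𝓝[≠] 0, 0 ≤ z.re → (1 - Complex.exp (-z)) ^ s *
      lubichFactor p (Complex.exp (-z)) ^ s = z ^ s * (lubichExp p z / z) ^ s := by
  have hre : {v : ℂ | 0 < v.re} ∈ 𝓝 (1 : ℂ) :=
    (isOpen_lt continuous_const Complex.continuous_re).mem_nhds (by simp)
  have t1 : Tendsto (fun z : ℂ => lubichExp 1 z / z) (𝓝[≠] 0) (𝓝 1) := by
    simpa using (tendsto_lubichExp_div le_rfl).add_const 1
  have t2 : Tendsto (fun z : ℂ => lubichFactor p (Complex.exp (-z))) (𝓝[≠] 0) (𝓝 1) := by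
    have : Continuous fun z : ℂ => lubichFactor p (Complex.exp (-z)) :=
      (differentiable_lubichFactor p).continuous.comp (by fun_prop)
    have h := (this.tendsto 0).mono_left (nhdsWithin_le_nhds (s := {0}ᶜ))
    simpa [lubichFactor_one hp] using h
  filter_upwards [self_mem_nhdsWithin, t1.eventually hre, t2.eventually hre] with z hz h1 h2 h0
  have hz0 : z ≠ 0 := hz
  have e1 : lubichExp 1 z = 1 - Complex.exp (-z) := by
    simp [lubichExp, lubichFactor]
  rw [e1] at h1
  have h10 : (1 - Complex.exp (-z)) / z ≠ 0 := by
    intro h; simp [h] at h1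
  rw [show 1 - Complex.exp (-z) = z * ((1 - Complex.exp (-z)) / z) by field_simp,
    mul_cpow_of_re hz0 h0 h1, mul_assoc, ← mul_cpow_of_re h10 h1.le h2, lubichExp]
  congr 2
  field_simp

/-- The symbol `e ^ (i r θ) ∑ₖ w k e ^ (-i k θ)` of the Grünwald operator with weights `w` and
shift `r`. -/
def gridSymbol (w : ℕ → ℝ) (r θ : ℝ) : ℂ :=
  Complex.exp (r * (θ * Complex.I)) * ∑' k, (w k : ℂ) * Complex.exp (-(θ * Complex.I)) ^ k

/-- The symbol agrees with `(i θ) ^ α (1 + c i θ)` up to `O(|θ| ^ (α + m))` at the origin. -/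
def SymbolExpansion (α : ℝ) (w : ℕ → ℝ) (r c : ℝ) (m : ℕ) : Prop :=
  (fun θ : ℝ => gridSymbol w r θ
    - (θ * Complex.I) ^ (α : ℂ) * (1 + c * (θ * Complex.I))) =O[𝓝[≠] 0]
      fun θ => |θ| ^ (α + m)

theorem gridSymbol_lubichWeight {α : ℝ} (hα : 0 < α) {p : ℕ} (hp : 1 ≤ p) (hp' : p ≤ 6) (r θ : ℝ) :
    gridSymbol (lubichWeight p α) r θ = Complex.exp (r * (θ * Complex.I)) *
      ((1 - Complex.exp (-(θ * Complex.I))) ^ (α : ℂ) *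
        lubichFactor p (Complex.exp (-(θ * Complex.I))) ^ (α : ℂ)) := by
  rw [gridSymbol, (lubichWeight_generating hα hp hp').2]
  rw [Complex.norm_exp]
  simp

theorem tendsto_ofReal_mul_I : Tendsto (fun θ : ℝ => (θ : ℂ) * Complex.I) (𝓝[≠] 0) (𝓝[≠] 0) := by
  refine tendsto_nhdsWithin_of_tendsto_nhds_of_eventually_within _ ?_ ?_
  · have : Continuous fun θ : ℝ => (θ : ℂ) * Complex.I := by fun_prop
    simpa using (this.tendsto 0).mono_left (nhdsWithin_le_nhds (s := {0}ᶜ))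
  · filter_upwards [self_mem_nhdsWithin] with θ hθ
    simpa using hθ

theorem cpow_mul_isBigO {α : ℝ} {m : ℕ} {E : ℂ → ℂ} (hE : E =O[𝓝[≠] 0] fun z => z ^ m) :
    (fun θ : ℝ => (θ * Complex.I) ^ (α : ℂ) * E (θ * Complex.I)) =O[𝓝[≠] 0]
      fun θ => |θ| ^ (α + m) := by
  have h1 : (fun θ : ℝ => ((θ : ℂ) * Complex.I) ^ (α : ℂ)) =O[𝓝[≠] 0] fun θ => |θ| ^ α := by
    refine IsBigO.of_bound 1 (Eventually.of_forall fun θ => ?_)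
    rw [Complex.norm_cpow_real]
    simp [abs_of_nonneg (Real.rpow_nonneg (abs_nonneg θ) α)]
  have h2 : (fun θ : ℝ => E (θ * Complex.I)) =O[𝓝[≠] 0] fun θ => |θ| ^ m := by
    refine (hE.comp_tendsto tendsto_ofReal_mul_I).trans
      (IsBigO.of_bound 1 (Eventually.of_forall fun θ => ?_))
    simp
  refine (h1.mul h2).congr' EventuallyEq.rfl ?_
  filter_upwards [self_mem_nhdsWithin] with θ hθ
  rw [Real.rpow_add (abs_pos.2 hθ), Real.rpow_natCast]

theorem symbolExpansion_lubich_of_isBigO {α : ℝ} (hα : 0 < α) {p : ℕ} (hp : 1 ≤ p) (hp' : p ≤ 6)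
    {r c : ℝ} {m : ℕ}
    (h : (fun z : ℂ => Complex.exp (r * z) * (lubichExp p z / z) ^ (α : ℂ) - (1 + c * z))
      =O[𝓝[≠] 0] fun z => z ^ m) :
    SymbolExpansion α (lubichWeight p α) r c m := by
  refine (cpow_mul_isBigO h).congr' ?_ EventuallyEq.rfl
  filter_upwards [tendsto_ofReal_mul_I.eventually (lubich_boundary_eq hp (α : ℂ))] with θ hθ
  rw [gridSymbol_lubichWeight hα hp hp', hθ (by simp)]
  ring

theorem symbolExpansion_lubich_unshifted {α : ℝ} (hα : 0 < α) {p : ℕ} (hp : 1 ≤ p) (hp' : p ≤ 6) :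
    SymbolExpansion α (lubichWeight p α) 0 0 p := by
  refine symbolExpansion_lubich_of_isBigO hα hp hp' ?_
  have h := ((one_add_cpow_isBigO (α : ℂ)).comp_tendsto (tendsto_lubichExp_div hp)).trans
    (lubichExp_div_sub_one_isBigO p)
  simpa [Function.comp_def] using h

/-- In the first-order coefficient, r comes from the factor e^(rz) and α · `lubichSecond p` from the
power of `lubichExp p z / z`. -/
theorem symbolExpansion_lubich_shifted {α : ℝ} (hα : 0 < α) {p : ℕ} (hp : 1 ≤ p) (hp' : p ≤ 6)
    (r : ℝ) :
    SymbolExpansion α (lubichWeight p α) r (r + α * lubichSecond p) 2 := by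
  refine symbolExpansion_lubich_of_isBigO hα hp hp' ?_
  have hv : (fun z : ℂ => lubichExp p z / z - 1) =O[𝓝[≠] 0] fun z => z := by
    have h0 : (fun z : ℂ => z ^ p) =O[𝓝[≠] 0] fun z => z := by
      refine IsBigO.of_bound 1 ?_
      filter_upwards [nhdsWithin_le_nhds (Metric.ball_mem_nhds (0 : ℂ) one_pos)] with z hz
      rw [norm_pow, one_mul]
      exact pow_le_of_le_one (norm_nonneg _) (by simpa using (Metric.mem_ball.1 hz).le) (by omega)
    exact (lubichExp_div_sub_one_isBigO p).trans h0
  have h1 : (fun z : ℂ => (lubichExp p z / z) ^ (α : ℂ) - 1 - α * (lubichExp p z / z - 1))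
      =O[𝓝[≠] 0] fun z => z ^ 2 := by
    have h := ((one_add_cpow_second_order (α : ℂ)).comp_tendsto (tendsto_lubichExp_div hp)).trans
      (hv.pow 2)
    simpa [Function.comp_def] using h
  have h2 : (fun z : ℂ => (lubichExp p z / z) ^ (α : ℂ) - 1 - α * (lubichSecond p * z))
      =O[𝓝[≠] 0] fun z => z ^ 2 := by
    refine (h1.add ((lubichExp_div_second_order hp).const_mul_left (α : ℂ))).congr_left
      fun z => ?_
    ring
  have hr : Tendsto (fun z : ℂ => (r : ℂ) * z) (𝓝[≠] 0) (𝓝 0) := by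
    have : Continuous fun z : ℂ => (r : ℂ) * z := by fun_prop
    simpa using (this.tendsto 0).mono_left (nhdsWithin_le_nhds (s := {0}ᶜ))
  have hrO : (fun z : ℂ => (r : ℂ) * z) =O[𝓝[≠] 0] fun z => z :=
    (isBigO_refl _ _).const_mul_left _
  have h3 : (fun z : ℂ => Complex.exp (r * z) - 1 - r * z) =O[𝓝[≠] 0] fun z => z ^ 2 := by
    have h := ((Complex.exp_sub_sum_range_isBigO_pow 2).comp_tendsto hr).trans (hrO.pow 2)
    refine h.congr_left fun z => ?_
    simp [Finset.sum_range_succ]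
    ring
  have h4 : (fun z : ℂ => (lubichExp p z / z) ^ (α : ℂ)) =O[𝓝[≠] 0] fun _ => (1 : ℂ) := by
    have h := (tendsto_lubichExp_div hp).add_const 1
    simp only [sub_add_cancel, zero_add] at h
    exact ((continuousAt_cpow_const (b := (α : ℂ)) (by simp)).tendsto.comp h).isBigO_one ℂ
  have h5 := h3.mul h4
  have h6 : (fun z : ℂ => r * z * ((lubichExp p z / z) ^ (α : ℂ) - 1)) =O[𝓝[≠] 0]
      fun z => z ^ 2 := by
    have h := hrO.mul (((one_add_cpow_isBigO (α : ℂ)).comp_tendsto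
      (tendsto_lubichExp_div hp)).trans hv)
    simpa [Function.comp_def, sq] using h
  simp only [mul_one] at h5
  -- With P the power of the quotient, the error splits as (e^(rz) - 1 - rz) P + rz (P - 1) + (P - 1
  -- - α · `lubichSecond p` · z).
  refine ((h5.add h6).add h2).congr_left fun z => ?_
  push_cast
  ring

theorem SymbolExpansion.order_one {α : ℝ} {w : ℕ → ℝ} {r c : ℝ} (h : SymbolExpansion α w r c 2) :
    SymbolExpansion α w r 0 1 := by
  have h1 : (fun θ : ℝ => |θ| ^ (α + (2 : ℕ))) =O[𝓝[≠] 0] fun θ => |θ| ^ (α + (1 : ℕ)) := by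
    refine IsBigO.of_bound 1 ?_
    filter_upwards [self_mem_nhdsWithin,
      nhdsWithin_le_nhds (Metric.ball_mem_nhds (0 : ℝ) one_pos)] with θ hθ hθ1
    rw [Real.norm_of_nonneg (by positivity), Real.norm_of_nonneg (by positivity), one_mul]
    exact Real.rpow_le_rpow_of_exponent_ge (abs_pos.2 hθ) (by simpa using (Metric.mem_ball.1 hθ1).le)
      (by norm_num)
  have h2 := cpow_mul_isBigO (α := α) (m := 1) (E := fun z => c * z)
    (by simpa using (isBigO_refl (fun z : ℂ => z) _).const_mul_left (c : ℂ))
  refine ((h.trans h1).add h2).congr_left fun θ => ?_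
  push_cast
  ring

/-! ### Fourier representation of smooth integrable functions -/

/-- The Fourier transform of a real function. -/
def realFourier (f : ℝ → ℝ) (ξ : ℝ) : ℂ := 𝓕 (fun x => (f x : ℂ)) ξ

/-- The plane wave `e ^ (2 π i x ξ)`. -/
def planeWave (x ξ : ℝ) : ℂ := Complex.exp (x * ((2 * Real.pi * ξ : ℝ) * Complex.I))

theorem norm_planeWave (x ξ : ℝ) : ‖planeWave x ξ‖ = 1 := by
  rw [planeWave, ← mul_assoc, ← Complex.ofReal_mul, Complex.norm_exp_ofReal_mul_I]

theorem continuous_planeWave (x : ℝ) : Continuous (planeWave x) := by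
  unfold planeWave; fun_prop

theorem fourierInv_eq_planeWave (g : ℝ → ℂ) (x : ℝ) :
    𝓕⁻ g x = ∫ ξ, g ξ * planeWave x ξ := by
  rw [Real.fourierInv_eq']
  refine integral_congr_ae (Eventually.of_forall fun ξ => ?_)
  simp only [smul_eq_mul, planeWave]
  rw [mul_comm]
  congr 2
  simp
  ring

theorem iteratedDeriv_complex_ofReal {N : ℕ} {f : ℝ → ℝ} (hf : ContDiff ℝ N f) {k : ℕ} (hk : k ≤ N) :
    iteratedDeriv k (fun x => (f x : ℂ)) = fun x => ((iteratedDeriv k f x : ℝ) : ℂ) := by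
  ext x
  have h := Complex.ofRealCLM.iteratedFDeriv_comp_left (hf.contDiffAt (x := x)) (i := k)
    (by exact_mod_cast hk)
  have h2 := congrArg (fun T => T fun _ => (1 : ℝ)) h
  simpa [iteratedDeriv, Function.comp_def] using h2

theorem IntegrablySmooth.mono {M N : ℕ} {f : ℝ → ℝ} (hf : IntegrablySmooth N f) (h : M ≤ N) :
    IntegrablySmooth M f :=
  ⟨hf.1.of_le (by exact_mod_cast h), fun k hk => hf.2 k (hk.trans h)⟩

namespace IntegrablySmooth

variable {N : ℕ} {f : ℝ → ℝ}

theorem integrable (hf : IntegrablySmooth N f) : Integrable fun x => (f x : ℂ) := by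
  have := hf.2 0 N.zero_le
  rw [iteratedDeriv_zero] at this
  exact this.ofReal

theorem fourier_iteratedDeriv (hf : IntegrablySmooth N f) {k : ℕ} (hk : k ≤ N) (ξ : ℝ) :
    realFourier (iteratedDeriv k f) ξ = (2 * Real.pi * Complex.I * ξ) ^ k * realFourier f ξ := by
  have h := Real.fourier_iteratedDeriv (f := fun x => (f x : ℂ)) (N := N) (n := k)
    (Complex.ofRealCLM.contDiff.comp hf.1) (fun j hj => ?_) (by exact_mod_cast hk)
  · rw [iteratedDeriv_complex_ofReal hf.1 hk] at h
    exact congrFun h ξ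
  · have hj' : j ≤ N := by exact_mod_cast hj
    rw [iteratedDeriv_complex_ofReal hf.1 hj']
    exact (hf.2 j hj').ofReal

theorem continuous_realFourier (hf : IntegrablySmooth N f) : Continuous (realFourier f) :=
  VectorFourier.fourierIntegral_continuous Real.continuous_fourierChar
    (by exact continuous_inner) hf.integrable

theorem norm_realFourier_le (f : ℝ → ℝ) (ξ : ℝ) :
    ‖realFourier f ξ‖ ≤ ∫ x, ‖(f x : ℂ)‖ :=
  VectorFourier.norm_fourierIntegral_le_integral_norm _ _ _ _ _

/-- The transforms of f and of its N-th derivative are both bounded; the two bounds combine through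
(1 + t)^N ≤ 2^(N-1) (1 + t^N). -/
theorem exists_fourier_decay (hf : IntegrablySmooth N f) :
    ∃ C, 0 ≤ C ∧ ∀ ξ, ‖realFourier f ξ‖ ≤ C * (1 + ‖ξ‖) ^ (-(N : ℝ)) := by
  set A := ∫ x, ‖(f x : ℂ)‖
  set B := ∫ x, ‖((iteratedDeriv N f x : ℝ) : ℂ)‖
  have hA : 0 ≤ A := integral_nonneg fun _ => norm_nonneg _
  have hB : 0 ≤ B := integral_nonneg fun _ => norm_nonneg _
  refine ⟨2 ^ (N - 1) * (A + B), by positivity, fun ξ => ?_⟩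
  have h1 : ‖realFourier f ξ‖ ≤ A := norm_realFourier_le f ξ
  have h2 : ‖ξ‖ ^ N * ‖realFourier f ξ‖ ≤ B := by
    have h := norm_realFourier_le (iteratedDeriv N f) ξ
    rw [hf.fourier_iteratedDeriv le_rfl, norm_mul, norm_pow] at h
    refine le_trans ?_ h
    gcongr
    simp only [norm_mul, Complex.norm_ofNat, Complex.norm_real, Complex.norm_I, mul_one,
      Real.norm_eq_abs, abs_of_pos Real.pi_pos]
    have := Real.pi_gt_three
    nlinarith [abs_nonneg ξ]
  have h3 := add_pow_le zero_le_one (norm_nonneg ξ) N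
  rw [Real.rpow_neg (by positivity), Real.rpow_natCast, ← div_eq_mul_inv,
    le_div_iff₀ (by positivity)]
  calc ‖realFourier f ξ‖ * (1 + ‖ξ‖) ^ N
      ≤ ‖realFourier f ξ‖ * (2 ^ (N - 1) * (1 ^ N + ‖ξ‖ ^ N)) := by gcongr
    _ = 2 ^ (N - 1) * (‖realFourier f ξ‖ + ‖ξ‖ ^ N * ‖realFourier f ξ‖) := by ring
    _ ≤ _ := by gcongr

theorem integrable_rpow_mul_fourier (hf : IntegrablySmooth N f) {s : ℝ} (hs : 0 ≤ s)
    (hsN : s + 1 < N) : Integrable fun ξ => |2 * Real.pi * ξ| ^ s * ‖realFourier f ξ‖ := by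
  obtain ⟨C, hC, hb⟩ := hf.exists_fourier_decay
  have hI : Integrable (fun ξ : ℝ => (1 + ‖ξ‖) ^ (-((N : ℝ) - s))) :=
    integrable_one_add_norm (by simp; linarith)
  have hc : Continuous fun ξ : ℝ => |2 * Real.pi * ξ| ^ s :=
    Continuous.rpow_const (by fun_prop) fun _ => Or.inr hs
  refine (hI.const_mul ((2 * Real.pi) ^ s * C)).mono'
    (hc.mul hf.continuous_realFourier.norm).aestronglyMeasurable (Eventually.of_forall fun ξ => ?_)
  rw [Real.norm_of_nonneg (by positivity)]
  have h1 : |2 * Real.pi * ξ| ^ s ≤ (2 * Real.pi) ^ s * (1 + ‖ξ‖) ^ s := by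
    rw [← Real.mul_rpow (by positivity) (by positivity)]
    refine Real.rpow_le_rpow (abs_nonneg _) ?_ hs
    rw [abs_mul, abs_of_pos Real.two_pi_pos, Real.norm_eq_abs]
    gcongr
    linarith
  calc _ ≤ (2 * Real.pi) ^ s * (1 + ‖ξ‖) ^ s * (C * (1 + ‖ξ‖) ^ (-(N : ℝ))) := by
        gcongr; exact hb ξ
    _ = _ := by
        rw [show -((N : ℝ) - s) = s + -(N : ℝ) by ring, Real.rpow_add (by positivity)]
        ring

theorem integrable_realFourier (hf : IntegrablySmooth N f) (hN : 2 ≤ N) :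
    Integrable (realFourier f) := by
  have h : Integrable fun ξ => |2 * Real.pi * ξ| ^ (0 : ℝ) * ‖realFourier f ξ‖ :=
    hf.integrable_rpow_mul_fourier le_rfl (by norm_num; exact_mod_cast hN)
  simp only [Real.rpow_zero, one_mul] at h
  exact (integrable_norm_iff hf.continuous_realFourier.aestronglyMeasurable).1 h

theorem fourier_inversion (hf : IntegrablySmooth N f) (hN : 2 ≤ N) (x : ℝ) :
    (f x : ℂ) = ∫ ξ, realFourier f ξ * planeWave x ξ := by
  have h := Continuous.fourierInv_fourier_eq (f := fun x => (f x : ℂ))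
    (Complex.continuous_ofReal.comp hf.1.continuous) hf.integrable (hf.integrable_realFourier hN)
  rw [← fourierInv_eq_planeWave]
  exact (congrFun h x).symm

theorem bounded (hf : IntegrablySmooth N f) (hN : 2 ≤ N) : ∃ B, ∀ x, |f x| ≤ B := by
  refine ⟨∫ ξ, ‖realFourier f ξ‖, fun x => ?_⟩
  rw [← Real.norm_eq_abs, ← Complex.norm_real, hf.fourier_inversion hN x]
  refine norm_integral_le_of_norm_le (hf.integrable_realFourier hN).norm
    (Eventually.of_forall fun ξ => ?_)
  rw [norm_mul, norm_planeWave, mul_one]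

/-- The origin is exempt because the multipliers to be cancelled vanish there; as a null set it does
not affect the inversion integral. -/
theorem eq_zero_of_fourier_ae_eq_zero (hf : IntegrablySmooth N f) (hN : 2 ≤ N)
    (h : ∀ ξ, ξ ≠ 0 → realFourier f ξ = 0) : f = 0 := by
  ext x
  have h0 : (f x : ℂ) = 0 := by
    rw [hf.fourier_inversion hN x]
    refine integral_eq_zero_of_ae ?_
    filter_upwards [Measure.ae_ne volume (0 : ℝ)] with ξ hξ
    simp [h ξ hξ]
  exact_mod_cast h0

/-- The Grünwald sum of a function in terms of its Fourier transform and the symbol. -/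
theorem grunwald_sum_eq (hf : IntegrablySmooth N f) (hN : 2 ≤ N) {w : ℕ → ℝ}
    (hw : Summable fun k => ‖w k‖) (r h x : ℝ) :
    ((∑' k : ℕ, w k * f (x - ((k : ℝ) - r) * h) : ℝ) : ℂ) =
      ∫ ξ, realFourier f ξ * planeWave x ξ * gridSymbol w r (h * (2 * Real.pi * ξ)) := by
  have hI := hf.integrable_realFourier hN
  have hwave : ∀ (k : ℕ) (ξ : ℝ), (w k : ℂ) * (realFourier f ξ * planeWave (x - (k - r) * h) ξ) =
      realFourier f ξ * planeWave x ξ *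
        (Complex.exp (r * ((h * (2 * Real.pi * ξ) : ℝ) * Complex.I)) *
        ((w k : ℂ) * Complex.exp (-((h * (2 * Real.pi * ξ) : ℝ) * Complex.I)) ^ k)) := by
    intro k ξ
    have : planeWave (x - (k - r) * h) ξ = planeWave x ξ *
        (Complex.exp (r * ((h * (2 * Real.pi * ξ) : ℝ) * Complex.I)) *
        Complex.exp (-((h * (2 * Real.pi * ξ) : ℝ) * Complex.I)) ^ k) := by
      simp only [planeWave]
      rw [← Complex.exp_nat_mul, ← Complex.exp_add, ← Complex.exp_add]
      congr 1
      push_cast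
      ring
    rw [this]; ring
  have hsum := hasSum_integral_of_summable_integral_norm
    (F := fun (k : ℕ) ξ => (w k : ℂ) * (realFourier f ξ * planeWave (x - (k - r) * h) ξ))
    (μ := volume) (fun k => ?_) ?_
  · rw [Complex.ofReal_tsum]
    refine Eq.trans (tsum_congr fun k => ?_) (hsum.tsum_eq.trans ?_)
    · rw [integral_const_mul, ← hf.fourier_inversion hN]
      push_cast; rfl
    · refine integral_congr_ae (Eventually.of_forall fun ξ => ?_)
      simp only [hwave]
      rw [tsum_mul_left, tsum_mul_left, gridSymbol]
  · refine Integrable.const_mul ?_ _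
    refine hI.mono (hf.continuous_realFourier.mul (continuous_planeWave _)).aestronglyMeasurable
      (Eventually.of_forall fun ξ => ?_)
    rw [norm_mul, norm_planeWave, mul_one]
  · have : ∀ k : ℕ, ∫ ξ, ‖(w k : ℂ) * (realFourier f ξ * planeWave (x - (k - r) * h) ξ)‖ =
        ‖w k‖ * ∫ ξ, ‖realFourier f ξ‖ := by
      intro k
      rw [← integral_const_mul]
      refine integral_congr_ae (Eventually.of_forall fun ξ => ?_)
      simp [norm_planeWave]
    simp only [this]
    exact hw.mul_right _

end IntegrablySmooth

/-! ### Global symbol bounds and the Fourier expansion of the operator -/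

theorem norm_gridSymbol_le {w : ℕ → ℝ} (hw : Summable fun k => ‖w k‖) (r θ : ℝ) :
    ‖gridSymbol w r θ‖ ≤ ∑' k, ‖w k‖ := by
  have h1 : ‖Complex.exp (r * (θ * Complex.I))‖ = 1 := by
    rw [← mul_assoc, ← Complex.ofReal_mul, Complex.norm_exp_ofReal_mul_I]
  have h2 : ‖Complex.exp (-(θ * Complex.I))‖ = 1 := by
    rw [← neg_mul, ← Complex.ofReal_neg, Complex.norm_exp_ofReal_mul_I]
  rw [gridSymbol, norm_mul, h1, one_mul]
  refine tsum_of_norm_bounded hw.hasSum fun k => ?_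
  rw [norm_mul, norm_pow, h2, one_pow, mul_one, Complex.norm_real]

theorem continuous_gridSymbol {w : ℕ → ℝ} (hw : Summable fun k => ‖w k‖) (r : ℝ) :
    Continuous (gridSymbol w r) := by
  unfold gridSymbol
  refine Continuous.mul (by fun_prop) (continuous_tsum (fun k => by fun_prop) hw fun k θ => ?_)
  have h2 : ‖Complex.exp (-(θ * Complex.I))‖ = 1 := by
    rw [← neg_mul, ← Complex.ofReal_neg, Complex.norm_exp_ofReal_mul_I]
  rw [norm_mul, norm_pow, h2, one_pow, mul_one, Complex.norm_real]

theorem norm_ofReal_mul_I_cpow (α θ : ℝ) : ‖((θ : ℂ) * Complex.I) ^ (α : ℂ)‖ = |θ| ^ α := by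
  rw [Complex.norm_cpow_real]; simp

/-- Near the origin lowering the exponent from m to s only weakens the bound. Away from it the
symbol is bounded and the model term grows like |θ|^α, or |θ|^(α+1) when c ≠ 0, whence the condition
s ≥ 1. Keeping s real lets it be adapted to the decay of the Fourier transform. -/
theorem SymbolExpansion.global_bound {α : ℝ} (hα : 0 < α) {w : ℕ → ℝ}
    (hw : Summable fun k => ‖w k‖) {r c : ℝ} {m : ℕ} (h : SymbolExpansion α w r c m) {s : ℝ}
    (hs0 : 0 ≤ s) (hsm : s ≤ m) (hc : c = 0 ∨ 1 ≤ s) :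
    ∃ K, ∀ θ : ℝ, θ ≠ 0 → ‖gridSymbol w r θ
      - (θ * Complex.I) ^ (α : ℂ) * (1 + c * (θ * Complex.I))‖ ≤ K * |θ| ^ (α + s) := by
  obtain ⟨C, hC⟩ := h.bound
  rw [eventually_nhdsWithin_iff, Metric.eventually_nhds_iff] at hC
  obtain ⟨ε, hε, hlocal⟩ := hC
  set δ := min ε 1 with hδ
  have hδ0 : 0 < δ := lt_min hε one_pos
  have hδ1 : δ ≤ 1 := min_le_right _ _
  set S := ∑' k, ‖w k‖
  have hS : 0 ≤ S := tsum_nonneg fun _ => norm_nonneg _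
  refine ⟨max C ((S + 1 + |c|) * (δ⁻¹) ^ (α + s)), fun θ hθ => ?_⟩
  have hθ0 : 0 < |θ| := abs_pos.2 hθ
  rcases lt_or_ge |θ| δ with hlt | hge
  · have h1 := hlocal (y := θ) (by simpa using hlt.trans_le (min_le_left _ _)) hθ
    rw [Real.norm_of_nonneg (by positivity)] at h1
    have hC0 : 0 ≤ C := by
      by_contra! hneg
      have : 0 < |θ| ^ (α + m) := by positivity
      nlinarith [norm_nonneg (gridSymbol w r θ
        - (θ * Complex.I) ^ (α : ℂ) * (1 + c * (θ * Complex.I)))]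
    have h2 : |θ| ^ (α + m) ≤ |θ| ^ (α + s) :=
      Real.rpow_le_rpow_of_exponent_ge hθ0 (hlt.le.trans hδ1) (by linarith)
    refine h1.trans ((mul_le_mul_of_nonneg_left h2 hC0).trans ?_)
    exact mul_le_mul_of_nonneg_right (le_max_left _ _) (by positivity)
  · set t := |θ| * δ⁻¹ with ht
    have ht1 : 1 ≤ t := by rw [ht, ← div_eq_mul_inv, le_div_iff₀ hδ0]; linarith
    have hθt : |θ| ≤ t := le_mul_of_one_le_right hθ0.le ((one_le_inv₀ hδ0).2 hδ1)
    have e1 : (1 : ℝ) ≤ t ^ (α + s) := Real.one_le_rpow ht1 (by linarith)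
    have e2 : |θ| ^ α ≤ t ^ (α + s) := (Real.rpow_le_rpow hθ0.le hθt hα.le).trans
      (Real.rpow_le_rpow_of_exponent_le ht1 (by linarith))
    have e3 : |θ| ^ α * (|c| * |θ|) ≤ |c| * t ^ (α + s) := by
      rcases hc with rfl | hs1
      · simp
      · have : |θ| ^ α * |θ| ≤ t ^ (α + s) := by
          rw [← Real.rpow_add_one hθ0.ne']
          exact (Real.rpow_le_rpow hθ0.le hθt (by linarith)).trans
            (Real.rpow_le_rpow_of_exponent_le ht1 (by linarith))
        calc _ = |c| * (|θ| ^ α * |θ|) := by ring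
          _ ≤ _ := by gcongr
    have e4 : ‖(1 : ℂ) + c * (θ * Complex.I)‖ ≤ 1 + |c| * |θ| := by
      refine (norm_add_le _ _).trans ?_
      simp
    calc _ ≤ ‖gridSymbol w r θ‖ + ‖(θ * Complex.I) ^ (α : ℂ) * (1 + c * (θ * Complex.I))‖ :=
          norm_sub_le _ _
      _ ≤ S + |θ| ^ α * (1 + |c| * |θ|) := by
          rw [norm_mul, norm_ofReal_mul_I_cpow]
          gcongr
          exact norm_gridSymbol_le hw r θ
      _ = S + |θ| ^ α + |θ| ^ α * (|c| * |θ|) := by ring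
      _ ≤ S * t ^ (α + s) + t ^ (α + s) + |c| * t ^ (α + s) := by
          gcongr
          exact le_mul_of_one_le_right hS e1
      _ = (S + 1 + |c|) * (δ⁻¹) ^ (α + s) * |θ| ^ (α + s) := by
          rw [ht, Real.mul_rpow hθ0.le (inv_nonneg.2 hδ0.le)]; ring
      _ ≤ _ := mul_le_mul_of_nonneg_right (le_max_right _ _) (by positivity)

/-- `(i η) ^ α` scales under positive dilations. -/
theorem ofReal_mul_I_cpow_smul {h : ℝ} (hh : 0 < h) (η : ℝ) (s : ℂ) :
    (((h * η : ℝ) : ℂ) * Complex.I) ^ s = (h : ℂ) ^ s * ((η : ℂ) * Complex.I) ^ s := by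
  rcases eq_or_ne η 0 with rfl | hη
  · rcases eq_or_ne s 0 with rfl | hs
    · simp
    · simp [hs]
  · have h0 : (h : ℂ) ≠ 0 := by exact_mod_cast hh.ne'
    rw [Complex.ofReal_mul, mul_assoc]
    refine mul_cpow_of_ne_zero h0 (by simp [hη]) ?_ s
    rw [Complex.arg_ofReal_of_nonneg hh.le, zero_add]
    exact Complex.arg_mem_Ioc _

/-- The Fourier integral with multiplier `(2 π i ξ) ^ α (2 π i ξ) ^ j`, which represents the
fractional derivative of order `α + j`. -/
def fourierDeriv (α : ℝ) (j : ℕ) (f : ℝ → ℝ) (x : ℝ) : ℂ :=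
  ∫ ξ, realFourier f ξ * planeWave x ξ * ((((2 * Real.pi * ξ : ℝ) : ℂ) * Complex.I) ^ (α : ℂ)
    * (((2 * Real.pi * ξ : ℝ) : ℂ) * Complex.I) ^ j)

theorem continuous_ofReal_mul_I_cpow {α : ℝ} (hα : 0 < α) :
    Continuous fun ξ : ℝ => (((2 * Real.pi * ξ : ℝ) : ℂ) * Complex.I) ^ (α : ℂ) := by
  refine continuous_iff_continuousAt.2 fun ξ => ?_
  refine ContinuousAt.comp (f := fun ξ : ℝ => ((2 * Real.pi * ξ : ℝ) : ℂ) * Complex.I)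
    (g := fun z : ℂ => z ^ (α : ℂ)) ?_ (by fun_prop)
  exact Complex.continuousAt_cpow_const_of_re_pos (Or.inl (by simp)) (by simpa using hα)

namespace IntegrablySmooth

variable {N : ℕ} {f : ℝ → ℝ}

theorem continuous_multiplier (hf : IntegrablySmooth N f) {α : ℝ} (hα : 0 < α) (j : ℕ) :
    Continuous fun ξ : ℝ => realFourier f ξ * ((((2 * Real.pi * ξ : ℝ) : ℂ) * Complex.I) ^ (α : ℂ)
      * (((2 * Real.pi * ξ : ℝ) : ℂ) * Complex.I) ^ j) :=
  hf.continuous_realFourier.mul ((continuous_ofReal_mul_I_cpow hα).mul (by fun_prop))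

theorem integrable_multiplier (hf : IntegrablySmooth N f) {α : ℝ} (hα : 0 < α) {j : ℕ}
    (hN : α + j + 1 < N) :
    Integrable fun ξ : ℝ => realFourier f ξ * ((((2 * Real.pi * ξ : ℝ) : ℂ) * Complex.I) ^ (α : ℂ)
      * (((2 * Real.pi * ξ : ℝ) : ℂ) * Complex.I) ^ j) := by
  have h := hf.integrable_rpow_mul_fourier (s := α + j) (by positivity) hN
  refine h.mono (hf.continuous_multiplier hα j).aestronglyMeasurable ?_
  filter_upwards [Measure.ae_ne volume (0 : ℝ)] with ξ hξ
  have hne : |2 * Real.pi * ξ| ≠ 0 := by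
    have := Real.pi_pos.ne'
    positivity
  rw [Real.norm_of_nonneg (by positivity), Real.rpow_add_natCast hne, norm_mul, norm_mul, norm_pow,
    norm_ofReal_mul_I_cpow, norm_mul, Complex.norm_real, Complex.norm_I, mul_one, Real.norm_eq_abs]
  exact (mul_comm _ _).le

theorem integrable_fourierDeriv_integrand (hf : IntegrablySmooth N f) {α : ℝ} (hα : 0 < α) {j : ℕ}
    (hN : α + j + 1 < N) (x : ℝ) :
    Integrable fun ξ : ℝ => realFourier f ξ * planeWave x ξ *
      ((((2 * Real.pi * ξ : ℝ) : ℂ) * Complex.I) ^ (α : ℂ)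
        * (((2 * Real.pi * ξ : ℝ) : ℂ) * Complex.I) ^ j) := by
  refine (hf.integrable_multiplier hα hN).mono ?_ (Eventually.of_forall fun ξ => ?_)
  · exact ((hf.continuous_realFourier.mul (continuous_planeWave x)).mul
      ((continuous_ofReal_mul_I_cpow hα).mul (by fun_prop))).aestronglyMeasurable
  · rw [norm_mul, norm_mul, norm_planeWave, mul_one, norm_mul (realFourier f ξ)]

/-- The product of the transform with the multiplier has zero inverse transform, so Fourier
inversion makes the product itself zero; off the origin the multiplier can be cancelled. -/
theorem eq_zero_of_fourierDeriv_eq_zero (hf : IntegrablySmooth N f) {α : ℝ} (hα : 0 < α) {j : ℕ}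
    (hN : α + j + 1 < N) (hN2 : 2 ≤ N) (h : ∀ x, fourierDeriv α j f x = 0) : f = 0 := by
  refine hf.eq_zero_of_fourier_ae_eq_zero hN2 fun ξ hξ => ?_
  set g : ℝ → ℂ := fun ξ : ℝ => realFourier f ξ *
    ((((2 * Real.pi * ξ : ℝ) : ℂ) * Complex.I) ^ (α : ℂ)
      * (((2 * Real.pi * ξ : ℝ) : ℂ) * Complex.I) ^ j) with hg
  have hinv : 𝓕⁻ g = 0 := by
    ext x
    rw [fourierInv_eq_planeWave]
    refine Eq.trans (integral_congr_ae (Eventually.of_forall fun ξ => ?_)) (h x)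
    simp only [hg]; ring
  have h2 : 𝓕 (𝓕⁻ g) = g := by
    refine Continuous.fourier_fourierInv_eq (hf.continuous_multiplier hα j)
      (hf.integrable_multiplier hα hN) ?_
    have : 𝓕 g = 0 := by
      ext y
      have h3 := congrFun hinv (-y)
      rwa [Real.fourierInv_eq_fourier_neg, neg_neg] at h3
    rw [this]
    exact integrable_zero _ _ _
  have hη : (((2 * Real.pi * ξ : ℝ) : ℂ) * Complex.I) ≠ 0 := by
    simp [hξ, Real.pi_ne_zero]
  have h4 : g ξ = 0 := by
    rw [← h2, hinv, Real.fourier_eq']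
    simp
  simpa only [hg, mul_eq_zero, Complex.cpow_eq_zero_iff, hη, false_and,
    pow_ne_zero j hη, or_false] using h4

/-- Expansion of the Grünwald operator in powers of the step, obtained from an expansion of its
symbol. -/
theorem norm_leftGrunwald_sub_le (hf : IntegrablySmooth N f) {α : ℝ} (hα : 0 < α)
    (hN : α + 2 < N) {w : ℕ → ℝ}
    (hw : Summable fun k => ‖w k‖) {r c : ℝ} {m : ℕ} (hS : SymbolExpansion α w r c m) {s : ℝ}
    (hs0 : 0 ≤ s) (hsm : s ≤ m) (hc : c = 0 ∨ 1 ≤ s) (hsN : α + s + 1 < N) (x : ℝ) :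
    ∃ K, ∀ h : ℝ, 0 < h → ‖(leftGrunwald α w r h f x : ℂ) - fourierDeriv α 0 f x
      - c * h * fourierDeriv α 1 f x‖ ≤ K * h ^ s := by
  have hN2 : 2 ≤ N := by
    have : (2 : ℝ) < N := by linarith
    exact_mod_cast this.le
  obtain ⟨K, hK⟩ := hS.global_bound hα hw hs0 hsm hc
  have hI := hf.integrable_rpow_mul_fourier (s := α + s) (by positivity) hsN
  refine ⟨K * ∫ ξ, |2 * Real.pi * ξ| ^ (α + s) * ‖realFourier f ξ‖, fun h hh => ?_⟩
  have h0 : (h : ℂ) ≠ 0 := by exact_mod_cast hh.ne'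
  have hhα : (h : ℂ) ^ (α : ℂ) ≠ 0 := by simp [Complex.cpow_eq_zero_iff, h0]
  have i0 := hf.integrable_fourierDeriv_integrand hα (j := 0) (by push_cast; linarith) x
  have i1 := hf.integrable_fourierDeriv_integrand hα (j := 1) (by push_cast; linarith) x
  have ig : Integrable fun ξ => realFourier f ξ * planeWave x ξ
      * gridSymbol w r (h * (2 * Real.pi * ξ)) := by
    refine ((hf.integrable_realFourier hN2).norm.mul_const (∑' k, ‖w k‖)).mono'
      ((hf.continuous_realFourier.mul (continuous_planeWave x)).mul
        ((continuous_gridSymbol hw r).comp (by fun_prop))).aestronglyMeasurable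
      (Eventually.of_forall fun ξ => ?_)
    rw [norm_mul, norm_mul, norm_planeWave, mul_one]
    exact mul_le_mul_of_nonneg_left (norm_gridSymbol_le hw _ _) (norm_nonneg _)
  -- By homogeneity of (iη)^α, the subtracted terms are h^(-α) times the model symbol at θ = hη. The
  -- global bound then contributes h^(-α) h^(α+s) = h^s.
  have e : (leftGrunwald α w r h f x : ℂ) - fourierDeriv α 0 f x - c * h * fourierDeriv α 1 f x =
      ∫ ξ, realFourier f ξ * planeWave x ξ * ((h : ℂ) ^ (α : ℂ))⁻¹ *
        (gridSymbol w r (h * (2 * Real.pi * ξ)) -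
          (((h * (2 * Real.pi * ξ) : ℝ) : ℂ) * Complex.I) ^ (α : ℂ) *
            (1 + c * (((h * (2 * Real.pi * ξ) : ℝ) : ℂ) * Complex.I))) := by
    rw [leftGrunwald, Complex.ofReal_mul, hf.grunwald_sum_eq hN2 hw, fourierDeriv, fourierDeriv,
      ← integral_const_mul, ← integral_const_mul, ← integral_sub (ig.const_mul _) i0,
      ← integral_sub (by exact (ig.const_mul _).sub i0) (i1.const_mul _)]
    refine integral_congr_ae (Eventually.of_forall fun ξ => ?_)
    simp only [ofReal_mul_I_cpow_smul hh]
    push_cast [Complex.ofReal_cpow hh.le]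
    field_simp
    ring
  rw [e]
  have hbound : ‖∫ ξ, realFourier f ξ * planeWave x ξ * ((h : ℂ) ^ (α : ℂ))⁻¹ *
        (gridSymbol w r (h * (2 * Real.pi * ξ)) -
          (((h * (2 * Real.pi * ξ) : ℝ) : ℂ) * Complex.I) ^ (α : ℂ) *
            (1 + c * (((h * (2 * Real.pi * ξ) : ℝ) : ℂ) * Complex.I)))‖ ≤
      ∫ ξ, K * h ^ s * (|2 * Real.pi * ξ| ^ (α + s) * ‖realFourier f ξ‖) := by
    refine norm_integral_le_of_norm_le (hI.const_mul _) ?_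
    filter_upwards [Measure.ae_ne volume (0 : ℝ)] with ξ hξ
    have hne : h * (2 * Real.pi * ξ) ≠ 0 := by
      have := Real.pi_pos.ne'
      positivity
    have hk := hK _ hne
    rw [abs_mul, abs_of_pos hh, Real.mul_rpow hh.le (abs_nonneg _), Real.rpow_add hh] at hk
    rw [norm_mul, norm_mul, norm_mul, norm_planeWave, mul_one, norm_inv,
      Complex.norm_cpow_eq_rpow_re_of_pos hh, Complex.ofReal_re]
    have hhr : 0 < h ^ α := by positivity
    calc _ ≤ ‖realFourier f ξ‖ * (h ^ α)⁻¹ *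
          (K * (h ^ α * h ^ s * |2 * Real.pi * ξ| ^ (α + s))) := by gcongr
      _ = _ := by field_simp
  refine hbound.trans_eq ?_
  rw [integral_const_mul]; ring

end IntegrablySmooth

/-! ### Integer order: moment conditions and Taylor expansion -/

/-- Letting θ → 0 kills the constant term; dividing by iθ then lowers M by one. -/
theorem coeff_eq_zero_of_isBigO (M : ℕ) (d : ℕ → ℂ)
    (h : (fun θ : ℝ => ∑ j ∈ Finset.range M, d j * (θ * Complex.I) ^ j) =O[𝓝[≠] 0]
      fun θ => |θ| ^ M) : ∀ j < M, d j = 0 := by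
  induction M generalizing d with
  | zero => intro j hj; omega
  | succ M ih =>
    simp only [Finset.sum_range_succ', pow_zero, mul_one] at h
    have hd0 : d 0 = 0 := by
      have t1 : Tendsto (fun θ : ℝ => ∑ j ∈ Finset.range M, d (j + 1) * (θ * Complex.I) ^ (j + 1)
          + d 0) (𝓝[≠] 0) (𝓝 0) := by
        refine h.trans_tendsto ?_
        have : Continuous fun θ : ℝ => |θ| ^ (M + 1) := by fun_prop
        simpa using (this.tendsto 0).mono_left (nhdsWithin_le_nhds (s := {0}ᶜ))
      have t2 : Tendsto (fun θ : ℝ => ∑ j ∈ Finset.range M, d (j + 1) * (θ * Complex.I) ^ (j + 1)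
          + d 0) (𝓝[≠] 0) (𝓝 (d 0)) := by
        have : Continuous fun θ : ℝ =>
            ∑ j ∈ Finset.range M, d (j + 1) * (θ * Complex.I) ^ (j + 1) + d 0 := by fun_prop
        simpa using (this.tendsto 0).mono_left (nhdsWithin_le_nhds (s := {0}ᶜ))
      exact tendsto_nhds_unique t2 t1
    have hrec : (fun θ : ℝ => ∑ j ∈ Finset.range M, d (j + 1) * (θ * Complex.I) ^ j) =O[𝓝[≠] 0]
        fun θ => |θ| ^ M := by
      have h2 := h.mul (isBigO_refl (fun θ : ℝ => ((θ : ℂ) * Complex.I)⁻¹) (𝓝[≠] 0)).norm_right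
      refine h2.congr' ?_ ?_
      · filter_upwards [self_mem_nhdsWithin] with θ hθ
        have hθ0 : (θ : ℂ) ≠ 0 := by exact_mod_cast hθ
        have hz : (θ : ℂ) * Complex.I ≠ 0 := mul_ne_zero hθ0 Complex.I_ne_zero
        rw [hd0, add_zero, Finset.sum_mul]
        refine Finset.sum_congr rfl fun j _ => ?_
        rw [pow_succ, mul_assoc, mul_assoc, mul_inv_cancel₀ hz, mul_one]
      · filter_upwards [self_mem_nhdsWithin] with θ hθ
        have hθ0 : |θ| ≠ 0 := abs_ne_zero.2 hθ
        simp only [norm_inv, norm_mul, Complex.norm_real, Complex.norm_I, mul_one, Real.norm_eq_abs]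
        field_simp
        ring
    intro j hj
    rcases j with _ | j
    · exact hd0
    · exact ih (fun j => d (j + 1)) hrec j (by omega)

theorem taylor_isBigO {f : ℝ → ℝ} {M : ℕ} (hf : ContDiff ℝ M f) (x : ℝ) :
    (fun t : ℝ => f (x + t) - ∑ j ∈ Finset.range M, iteratedDeriv j f x * t ^ j / j.factorial)
      =O[𝓝 0] fun t => t ^ M := by
  have h := (taylor_isLittleO_univ (x₀ := x) hf).isBigO
  have ht : Tendsto (fun t : ℝ => x + t) (𝓝 0) (𝓝 x) := by
    have : Continuous fun t : ℝ => x + t := by fun_prop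
    simpa using this.tendsto 0
  have h2 := h.comp_tendsto ht
  have h3 : (fun t : ℝ => (M.factorial : ℝ)⁻¹ * iteratedDeriv M f x * t ^ M) =O[𝓝 0]
      fun t => t ^ M := (isBigO_refl _ _).const_mul_left _
  have h4 : (fun t : ℝ => t ^ M) = (fun y => (y - x) ^ M) ∘ fun t => x + t := by
    ext t; simp
  rw [← h4] at h2
  refine (h2.add h3).congr_left fun t => ?_
  simp only [Function.comp_apply, taylor_within_apply, Finset.sum_range_succ, smul_eq_mul,
    iteratedDerivWithin_univ, add_sub_cancel_left]
  have : ∀ j, (j.factorial : ℝ)⁻¹ * t ^ j * iteratedDeriv j f x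
      = iteratedDeriv j f x * t ^ j / j.factorial := fun j => by
    rw [div_eq_mul_inv]; ring
  simp only [this]
  ring

theorem exp_sub_sum_isBigO (a : ℂ) (M : ℕ) :
    (fun θ : ℝ => Complex.exp (a * (θ * Complex.I))
      - ∑ j ∈ Finset.range M, a ^ j / j.factorial * (θ * Complex.I) ^ j) =O[𝓝[≠] 0]
      fun θ => |θ| ^ M := by
  have ht : Tendsto (fun θ : ℝ => a * ((θ : ℂ) * Complex.I)) (𝓝[≠] 0) (𝓝 0) := by
    have : Continuous fun θ : ℝ => a * ((θ : ℂ) * Complex.I) := by fun_prop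
    simpa using (this.tendsto 0).mono_left (nhdsWithin_le_nhds (s := {0}ᶜ))
  have h := (Complex.exp_sub_sum_range_isBigO_pow M).comp_tendsto ht
  have h2 : (fun θ : ℝ => (a * ((θ : ℂ) * Complex.I)) ^ M) =O[𝓝[≠] 0] fun θ => |θ| ^ M := by
    refine IsBigO.of_bound (‖a‖ ^ M) (Eventually.of_forall fun θ => ?_)
    simp [mul_pow]
  refine (h.trans h2).congr_left fun θ => ?_
  simp only [Function.comp_apply]
  congr 1
  refine Finset.sum_congr rfl fun j _ => ?_
  rw [mul_pow]; ring

/-- The index n + 1 lies in the range only for m ≥ 2; for m = 1 the term is lost, which is harmless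
only if c = 0. -/
theorem sum_ite_two_terms {R : Type*} [CommRing R] {n m : ℕ} {c : R} (hm0 : 1 ≤ m)
    (hm : c = 0 ∨ 2 ≤ m) (X : ℕ → R) :
    ∑ j ∈ Finset.range (n + m), ((if j = n then 1 else 0) + if j = n + 1 then c else 0) * X j
      = X n + c * X (n + 1) := by
  simp only [add_mul, Finset.sum_add_distrib, ite_mul, one_mul, zero_mul, Finset.sum_ite_eq',
    Finset.mem_range]
  rw [if_pos (by omega)]
  rcases hm with rfl | h2
  · simp
  · rw [if_pos (by omega)]

/-- The moments of finitely supported weights whose symbol expands as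
`(i θ) ^ n (1 + c i θ) + O(|θ| ^ (n + m))`. -/
theorem SymbolExpansion.moments {n : ℕ} {w : ℕ → ℝ} {K : ℕ} (hw : ∀ k, K ≤ k → w k = 0)
    {r c : ℝ} {m : ℕ} (hm0 : 1 ≤ m) (hm : c = 0 ∨ 2 ≤ m)
    (h : SymbolExpansion n w r c m) :
    ∀ j < n + m, ∑ k ∈ Finset.range K, w k * (r - k) ^ j / j.factorial
      = (if j = n then 1 else 0) + if j = n + 1 then c else 0 := by
  set M := n + m
  have hsym : ∀ θ : ℝ, gridSymbol w r θ =
      ∑ k ∈ Finset.range K, (w k : ℂ) * Complex.exp (((r - k : ℝ) : ℂ) * (θ * Complex.I)) := by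
    intro θ
    rw [gridSymbol, tsum_eq_sum (s := Finset.range K), Finset.mul_sum]
    · refine Finset.sum_congr rfl fun k _ => ?_
      rw [← Complex.exp_nat_mul, mul_left_comm, ← Complex.exp_add]
      congr 2
      push_cast; ring
    · intro k hk
      rw [hw k (by simpa using hk)]; simp
  have hT := IsBigO.sum (s := Finset.range K) (l := 𝓝[≠] (0 : ℝ)) fun k _ =>
    (exp_sub_sum_isBigO ((r - k : ℝ) : ℂ) M).const_mul_left (w k : ℂ)
  have hE : ∀ θ : ℝ, ∑ j ∈ Finset.range M,
      (((if j = n then 1 else 0) + if j = n + 1 then c else 0 : ℝ) : ℂ) * (θ * Complex.I) ^ j =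
      ((θ : ℂ) * Complex.I) ^ n * (1 + c * (θ * Complex.I)) := by
    intro θ
    have := sum_ite_two_terms (n := n) (c := (c : ℂ)) hm0 (hm.imp_left fun h => by simp [h])
      fun j => ((θ : ℂ) * Complex.I) ^ j
    push_cast [apply_ite Complex.ofReal]
    refine this.trans ?_
    rw [pow_succ]
    ring
  have hS : (fun θ : ℝ => gridSymbol w r θ - ((θ : ℂ) * Complex.I) ^ n *
      (1 + c * (θ * Complex.I))) =O[𝓝[≠] 0] fun θ => |θ| ^ M := by
    refine IsBigO.congr' h ?_ ?_
    · exact Eventually.of_forall fun θ => by simp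
    · filter_upwards with θ
      rw [← Nat.cast_add, Real.rpow_natCast]
  -- The finite exponential sum has a Taylor polynomial with the moments as coefficients; it agrees
  -- with the prescribed expansion up to O(|θ|^M), so the coefficients below M coincide.
  have hd := coeff_eq_zero_of_isBigO M (fun j => ((∑ k ∈ Finset.range K,
    w k * (r - k) ^ j / j.factorial : ℝ) : ℂ) -
      (((if j = n then 1 else 0) + if j = n + 1 then c else 0 : ℝ) : ℂ)) ?_
  · intro j hj
    have := sub_eq_zero.1 (hd j hj)
    exact_mod_cast this
  · refine (hS.sub hT).congr_left fun θ => ?_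
    rw [Finset.sum_apply, hsym]
    simp only [mul_sub, sub_mul, Finset.sum_sub_distrib, Finset.mul_sum, hE]
    rw [Finset.sum_comm (s := Finset.range K)]
    have : ∀ j ∈ Finset.range M, ∑ k ∈ Finset.range K, (w k : ℂ) *
        (((r - k : ℝ) : ℂ) ^ j / j.factorial * (θ * Complex.I) ^ j) =
        ((∑ k ∈ Finset.range K, w k * (r - k) ^ j / j.factorial : ℝ) : ℂ) *
          (θ * Complex.I) ^ j := by
      intro j _
      push_cast
      rw [Finset.sum_mul]
      exact Finset.sum_congr rfl fun k _ => by ring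
    rw [Finset.sum_congr rfl this]
    ring

/-- Expansion of the Grünwald operator with finitely supported weights and integer order. -/
theorem leftGrunwald_sub_isBigO {n : ℕ} {w : ℕ → ℝ} {K : ℕ} (hw : ∀ k, K ≤ k → w k = 0)
    {r c : ℝ} {m : ℕ} (hm0 : 1 ≤ m) (hm : c = 0 ∨ 2 ≤ m) (h : SymbolExpansion n w r c m)
    {f : ℝ → ℝ} (hf : ContDiff ℝ (n + m : ℕ) f) (x : ℝ) :
    (fun t : ℝ => leftGrunwald n w r t f x - iteratedDeriv n f x
      - c * t * iteratedDeriv (n + 1) f x) =O[𝓝[>] 0] fun t => t ^ m := by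
  have hmom := h.moments hw hm0 hm
  have hterm : ∀ k ∈ Finset.range K, (fun t : ℝ => w k * (f (x + (r - k) * t) -
      ∑ j ∈ Finset.range (n + m), iteratedDeriv j f x * ((r - k) * t) ^ j / j.factorial))
      =O[𝓝[>] 0] fun t => t ^ (n + m) := by
    intro k _
    have ht : Tendsto (fun t : ℝ => (r - k) * t) (𝓝[>] 0) (𝓝 0) := by
      have : Continuous fun t : ℝ => (r - k) * t := by fun_prop
      simpa using (this.tendsto 0).mono_left (nhdsWithin_le_nhds (s := Set.Ioi 0))
    have h2 : (fun t : ℝ => ((r - k) * t) ^ (n + m)) =O[𝓝[>] 0] fun t => t ^ (n + m) := by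
      simp only [mul_pow]
      exact (isBigO_refl _ _).const_mul_left _
    exact (((taylor_isBigO hf x).comp_tendsto ht).trans h2).const_mul_left (w k)
  have hsum := (IsBigO.sum hterm).mul
    (isBigO_refl (fun t : ℝ => (t ^ n)⁻¹) (𝓝[>] 0))
  refine hsum.congr' ?_ ?_
  · filter_upwards [self_mem_nhdsWithin] with t ht
    have ht0 : t ≠ 0 := (Set.mem_Ioi.1 ht).ne'
    have htn : t ^ n ≠ 0 := pow_ne_zero n ht0
    rw [Finset.sum_apply, leftGrunwald, tsum_eq_sum (s := Finset.range K) (fun k hk => by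
      rw [hw k (by simpa using hk), zero_mul]), Real.rpow_natCast]
    simp only [mul_sub, Finset.sum_sub_distrib, Finset.mul_sum]
    rw [Finset.sum_comm (s := Finset.range K)]
    -- The moments annihilate every Taylor term of f except those of order n and n + 1.
    have e1 : ∀ j ∈ Finset.range (n + m), ∑ k ∈ Finset.range K,
        w k * (iteratedDeriv j f x * ((r - k) * t) ^ j / j.factorial) =
        ((if j = n then 1 else 0) + if j = n + 1 then c else 0)
          * (iteratedDeriv j f x * t ^ j) := by
      intro j hj
      rw [← hmom j (Finset.mem_range.1 hj), Finset.sum_mul]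
      refine Finset.sum_congr rfl fun k _ => ?_
      rw [mul_pow]; ring
    have e2 : ∀ k : ℕ, x - ((k : ℝ) - r) * t = x + (r - k) * t := fun k => by ring
    rw [Finset.sum_congr rfl e1, sum_ite_two_terms hm0 hm]
    simp only [e2]
    rw [← Finset.mul_sum]
    generalize ∑ k ∈ Finset.range K, w k * f (x + (r - k) * t) = S
    field_simp
    ring
  · filter_upwards [self_mem_nhdsWithin] with t ht
    have ht0 : t ≠ 0 := (Set.mem_Ioi.1 ht).ne'
    field_simp
    ring

/-- For integer order the Lubich function is a polynomial, so that its weights have finite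
support. -/
theorem lubichWeight_natCast_eq_zero {p : ℕ} (hp : 1 ≤ p) (n : ℕ) :
    ∃ K, ∀ k, K ≤ k → lubichWeight p (n : ℝ) k = 0 := by
  let Q : Polynomial ℝ :=
    (∑ j ∈ Finset.Icc 1 p, Polynomial.C (1 / (j : ℝ)) * (1 - Polynomial.X) ^ j) ^ n
  have hQ : ∀ x : ℝ, Q.eval x = lubichGen p n x := by
    intro x
    simp only [Q, lubichGen, Real.rpow_natCast, Polynomial.eval_pow, Polynomial.eval_finsetSum,
      Polynomial.eval_mul, Polynomial.eval_C, Polynomial.eval_sub, Polynomial.eval_one,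
      Polynomial.eval_X]
    congr 1
    exact Finset.sum_congr rfl fun j _ => by ring
  refine ⟨Q.natDegree + 1, fun k hk => ?_⟩
  have h := eq_taylor_of_hasSum (analyticAt_lubichGen hp n) (c := fun k => (Q.coeff k : ℂ)) ?_ k
  · rw [Polynomial.coeff_eq_zero_of_natDegree_lt (by omega)] at h
    exact_mod_cast h.symm
  · refine Eventually.of_forall fun x => ?_
    rw [← hQ, Polynomial.eval_eq_sum_range]
    push_cast
    refine hasSum_sum_of_ne_finset_zero fun k hk => ?_
    rw [Polynomial.coeff_eq_zero_of_natDegree_lt (by simpa using hk)]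
    simp

theorem rpow_isLittleO_id {s : ℝ} (hs : 1 < s) :
    (fun h : ℝ => h ^ s) =o[𝓝[>] 0] fun h => h := by
  have h1 : (fun h : ℝ => h ^ (s - 1)) =o[𝓝[>] 0] fun _ => (1 : ℝ) := by
    rw [isLittleO_one_iff]
    have h := (Real.continuousAt_rpow_const 0 (s - 1) (Or.inr (by linarith))).tendsto.mono_left
      (nhdsWithin_le_nhds (s := Set.Ioi 0))
    rwa [Real.zero_rpow (by linarith)] at h
  refine ((isBigO_refl (fun h : ℝ => h) (𝓝[>] 0)).mul_isLittleO h1).congr' ?_ (by simp)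
  filter_upwards [self_mem_nhdsWithin] with h hh
  rw [Real.rpow_sub_one (Set.mem_Ioi.1 hh).ne']
  field_simp [(Set.mem_Ioi.1 hh).ne']

/-! ### Expansion of the operator for all orders -/

/-- A smooth integrable function has functions `D` and `D₁`, playing the role of its derivatives of
order `α` and `α + 1`, which are the first coefficients of the expansions of all Grünwald operators
with consistent symbols. -/
theorem IntegrablySmooth.exists_expansion {α : ℝ} (hα : 0 < α) {n : ℕ} (hn : α ≤ n) {N : ℕ}
    (hN : n + 2 ≤ N) {f : ℝ → ℝ} (hf : IntegrablySmooth N f) :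
    ∃ D D₁ : ℝ → ℂ, ((∀ x, D₁ x = 0) → f = 0) ∧
      ∀ (w : ℕ → ℝ) (r : ℝ), (Summable fun k => ‖w k‖) →
        (∀ j : ℕ, α = j → ∃ K, ∀ k, K ≤ k → w k = 0) →
        (∀ m : ℕ, 1 ≤ m → n + m + 1 ≤ N → SymbolExpansion α w r 0 m → ∀ x,
          (fun h : ℝ => (leftGrunwald α w r h f x : ℂ) - D x) =O[𝓝[>] 0] fun h => h ^ (m : ℝ)) ∧
        (∀ c : ℝ, SymbolExpansion α w r c 2 → ∀ x,
          (fun h : ℝ => (leftGrunwald α w r h f x : ℂ) - D x - c * h * D₁ x)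
            =o[𝓝[>] 0] fun h => h) := by
  -- For α = n and N = n + m + 1 the Fourier bound would need α + m + 1 < N, which just fails; the
  -- finite support of the weights replaces it.
  rcases eq_or_lt_of_le hn with rfl | hlt
  · refine ⟨fun x => ((iteratedDeriv n f x : ℝ) : ℂ), fun x => ((iteratedDeriv (n + 1) f x : ℝ) : ℂ),
      fun h => ?_, fun w r hw hfin => ⟨fun m hm hmN hS x => ?_, fun c hS x => ?_⟩⟩
    · refine hf.eq_zero_of_fourier_ae_eq_zero (by omega) fun ξ hξ => ?_
      have h1 := hf.fourier_iteratedDeriv (show n + 1 ≤ N by omega) ξ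
      have h2 : realFourier (iteratedDeriv (n + 1) f) ξ = 0 := by
        rw [realFourier, Real.fourier_eq']
        simp [h]
      rw [h2] at h1
      have h3 : (2 * Real.pi * Complex.I * ξ : ℂ) ^ (n + 1) ≠ 0 := by
        refine pow_ne_zero _ ?_
        simp [Real.pi_ne_zero, hξ]
      exact (mul_eq_zero.1 h1.symm).resolve_left h3
    · obtain ⟨K, hK⟩ := hfin n rfl
      have h := leftGrunwald_sub_isBigO hK hm (Or.inl rfl) hS
        (hf.1.of_le (by exact_mod_cast (by omega : n + m ≤ N))) x
      simp only [zero_mul, sub_zero, ← Real.rpow_natCast] at h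
      simpa only [Complex.ofReal_sub] using Complex.isBigO_ofReal_left.2 h
    · obtain ⟨K, hK⟩ := hfin n rfl
      have h := leftGrunwald_sub_isBigO hK one_le_two (Or.inr le_rfl) hS
        (hf.1.of_le (by exact_mod_cast hN)) x
      have h2 := (Complex.isBigO_ofReal_left.2 h).trans_isLittleO
        ((rpow_isLittleO_id one_lt_two).congr_left fun t => Real.rpow_two t)
      refine h2.congr_left fun t => ?_
      push_cast
      rfl
  · have hnN : (n : ℝ) + 2 ≤ N := by exact_mod_cast hN
    have hαN : α + 2 < N := by linarith
    refine ⟨fourierDeriv α 0 f, fourierDeriv α 1 f, fun h => ?_,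
      fun w r hw _ => ⟨fun m hm hmN hS x => ?_, fun c hS x => ?_⟩⟩
    · exact hf.eq_zero_of_fourierDeriv_eq_zero hα (by push_cast; linarith) (by omega) h
    · have hmN' : (n : ℝ) + m + 1 ≤ N := by exact_mod_cast hmN
      obtain ⟨K, hK⟩ := hf.norm_leftGrunwald_sub_le hα hαN hw hS m.cast_nonneg le_rfl
        (Or.inl rfl) (by linarith) x
      refine IsBigO.of_bound K ?_
      filter_upwards [self_mem_nhdsWithin] with h hh
      have := hK h hh
      rw [Real.norm_of_nonneg (Real.rpow_nonneg (Set.mem_Ioi.1 hh).le _)]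
      simpa using this
    -- The exponent must exceed 1 to give o(h), stay at most 2, and satisfy α + s + 1 < n + 2; half
    -- of the gap n - α leaves room for the strict inequality.
    · set s : ℝ := 1 + min 1 ((n - α) / 2) with hs
      have hs1 : 1 < s := by
        have : 0 < min 1 ((n - α) / 2) := lt_min one_pos (by linarith)
        linarith
      have hs2 : s ≤ (2 : ℕ) := by
        have : min 1 ((n - α) / 2) ≤ 1 := min_le_left _ _
        push_cast; linarith
      have hs3 : s ≤ 1 + (n - α) / 2 := by
        have : min 1 ((n - α) / 2) ≤ (n - α) / 2 := min_le_right _ _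
        linarith
      obtain ⟨K, hK⟩ := hf.norm_leftGrunwald_sub_le hα hαN hw hS (by linarith) hs2
        (Or.inr hs1.le) (by linarith) x
      refine IsBigO.trans_isLittleO (IsBigO.of_bound K ?_) (rpow_isLittleO_id hs1)
      filter_upwards [self_mem_nhdsWithin] with h hh
      rw [Real.norm_of_nonneg (Real.rpow_nonneg (Set.mem_Ioi.1 hh).le _)]
      exact hK h hh

/-! ### Approximation orders from symbol expansions -/

theorem summable_weight_mul {w : ℕ → ℝ} (hw : Summable fun k => ‖w k‖) {N : ℕ} (hN : 2 ≤ N)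
    {f : ℝ → ℝ} (hf : IntegrablySmooth N f) (y : ℕ → ℝ) : Summable fun k => w k * f (y k) := by
  obtain ⟨B, hB⟩ := hf.bounded hN
  refine Summable.of_norm_bounded (hw.mul_right B) fun k => ?_
  rw [norm_mul]
  exact mul_le_mul_of_nonneg_left (hB _) (norm_nonneg _)

theorem leftGL_sum_eq {α : ℝ} (hα : 0 < α) (f : ℝ → ℝ) (x h : ℝ) :
    1 / h ^ α * ∑' k : ℕ, glWeight α k * f (x - (k : ℝ) * h)
      = leftGrunwald α (lubichWeight 1 α) 0 h f x := by
  simp only [leftGrunwald, sub_zero, glWeight_eq_lubichWeight hα]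

theorem hasLeftGLDeriv_iff {α : ℝ} (hα : 0 < α) {N : ℕ} (hN : 2 ≤ N) {f : ℝ → ℝ}
    (hf : IntegrablySmooth N f) (x L : ℝ) : HasLeftGLDeriv α f x L ↔
      Tendsto (fun h => leftGrunwald α (lubichWeight 1 α) 0 h f x) (𝓝[>] 0) (𝓝 L) := by
  simp only [HasLeftGLDeriv, leftGL_sum_eq hα]
  exact and_iff_right fun h _ => summable_weight_mul (summable_norm_glWeight hα) hN hf _

section

variable {α : ℝ} {n p N : ℕ} {f : ℝ → ℝ}

theorem lubichWeight_finite_of_integer (hp : 1 ≤ p) (j : ℕ) (hj : α = j) :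
    ∃ K, ∀ k, K ≤ k → lubichWeight p α k = 0 := by
  subst hj; exact lubichWeight_natCast_eq_zero hp j

theorem tendsto_of_isBigO_rpow {F : ℝ → ℂ} {d : ℂ} {q : ℝ} (hq : 0 < q)
    (h : (fun t => F t - d) =O[𝓝[>] 0] fun t : ℝ => t ^ q) : Tendsto F (𝓝[>] 0) (𝓝 d) := by
  have h0 : Tendsto (fun t : ℝ => t ^ q) (𝓝[>] 0) (𝓝 0) := by
    have h := (Real.continuousAt_rpow_const 0 q (Or.inr hq.le)).tendsto.mono_left
      (nhdsWithin_le_nhds (s := Set.Ioi 0))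
    rwa [Real.zero_rpow hq.ne'] at h
  exact tendsto_sub_nhds_zero_iff.1 (h.trans_tendsto h0)

/-- The leading coefficient D is common to all consistent symbols. Applied to the weights with p = 1
and no shift, the expansion shows that D is the Grünwald–Letnikov derivative. -/
theorem leftApproxOrder_of_symbolExpansion (hα : 0 < α) (hn : α ≤ n) (hp : 1 ≤ p) (hp' : p ≤ 6)
    {r : ℝ} {m : ℕ} (hm : 1 ≤ m) (hf : IntegrablySmooth (m + n + 1) f)
    (hS : SymbolExpansion α (lubichWeight p α) r 0 m) :
    LeftApproxOrder α (lubichWeight p α) r m f := by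
  obtain ⟨D, D₁, -, hD⟩ := hf.exists_expansion hα hn (by omega)
  intro x
  have hgl := (hD (lubichWeight 1 α) 0 (lubichWeight_generating hα le_rfl (by norm_num)).1
    (lubichWeight_finite_of_integer le_rfl)).1 1 le_rfl (by omega)
    (symbolExpansion_lubich_unshifted hα le_rfl (by norm_num)) x
  have hw := (lubichWeight_generating hα hp hp').1
  refine ⟨(D x).re, ?_, fun h _ => summable_weight_mul hw (by omega) hf _, ?_⟩
  · rw [hasLeftGLDeriv_iff hα (by omega) hf]
    exact (Complex.continuous_re.tendsto _).comp (tendsto_of_isBigO_rpow (by norm_num) hgl)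
  · refine IsBigO.trans (IsBigO.of_bound 1 (Eventually.of_forall fun h => ?_))
      ((hD _ r hw (lubichWeight_finite_of_integer hp)).1 m hm (by omega) hS x)
    rw [one_mul, Real.norm_eq_abs]
    simpa using Complex.abs_re_le_norm ((leftGrunwald α (lubichWeight p α) r h f x : ℂ) - D x)

/-- Order q > 1 makes the total error o(h), so its first-order term c h D₁(x) is o(h) as well. Since
c ≠ 0, D₁ vanishes everywhere, which forces f = 0. -/
theorem not_leftApproxOrder_of_symbolExpansion (hα : 0 < α) (hn : α ≤ n) (hp : 1 ≤ p)
    (hp' : p ≤ 6) {r c : ℝ} (hc : c ≠ 0) (hf : IntegrablySmooth (n + 2) f)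
    (hS : SymbolExpansion α (lubichWeight p α) r c 2) (hf0 : f ≠ 0) {q : ℝ} (hq : 1 < q) :
    ¬ LeftApproxOrder α (lubichWeight p α) r q f := by
  intro hL
  obtain ⟨D, D₁, hzero, hD⟩ := hf.exists_expansion hα hn le_rfl
  refine hf0 (hzero fun x => ?_)
  obtain ⟨L, hGL, -, hO⟩ := hL x
  have hgl := (hD (lubichWeight 1 α) 0 (lubichWeight_generating hα le_rfl (by norm_num)).1
    (lubichWeight_finite_of_integer le_rfl)).1 1 le_rfl (by omega)
    (symbolExpansion_lubich_unshifted hα le_rfl (by norm_num)) x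
  have hDL : D x = L := by
    rw [hasLeftGLDeriv_iff hα (by omega) hf] at hGL
    exact tendsto_nhds_unique (tendsto_of_isBigO_rpow (by norm_num) hgl)
      ((Complex.continuous_ofReal.tendsto _).comp hGL)
  have h1 := (hD _ r (lubichWeight_generating hα hp hp').1
    (lubichWeight_finite_of_integer hp)).2 c hS x
  have h2 : (fun h : ℝ => (leftGrunwald α (lubichWeight p α) r h f x : ℂ) - D x)
      =o[𝓝[>] 0] fun h => h := by
    have := (Complex.isBigO_ofReal_left.2 hO).trans_isLittleO (rpow_isLittleO_id hq)
    simpa only [Complex.ofReal_sub, hDL] using this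
  have h3 : (fun h : ℝ => c * h * D₁ x) =o[𝓝[>] 0] fun h => h :=
    (h2.sub h1).congr_left fun h => by ring
  have h4 : (fun _ : ℝ => c * D₁ x) =o[𝓝[>] 0] fun _ => (1 : ℝ) := by
    refine (h3.mul_isBigO (Complex.isBigO_ofReal_left.2
      (isBigO_refl (fun h : ℝ => h⁻¹) (𝓝[>] 0)))).congr' ?_ ?_
    · filter_upwards [self_mem_nhdsWithin] with h hh
      have : (h : ℂ) ≠ 0 := by exact_mod_cast (Set.mem_Ioi.1 hh).ne'
      push_cast
      field_simp
    · filter_upwards [self_mem_nhdsWithin] with h hh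
      exact mul_inv_cancel₀ (Set.mem_Ioi.1 hh).ne'
  have h5 : (c : ℂ) * D₁ x = 0 :=
    tendsto_nhds_unique tendsto_const_nhds ((isLittleO_one_iff ℝ).1 h4)
  exact (mul_eq_zero.1 h5).resolve_left (by exact_mod_cast hc)

end

/-! ### Reflection to the right-sided operators, and the main theorem -/

theorem IntegrablySmooth.comp_neg {N : ℕ} {f : ℝ → ℝ} (hf : IntegrablySmooth N f) :
    IntegrablySmooth N fun x => f (-x) := by
  refine ⟨hf.1.comp contDiff_neg, fun k hk => ?_⟩
  have : iteratedDeriv k (fun x => f (-x)) = fun x => (-1 : ℝ) ^ k • iteratedDeriv k f (-x) := by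
    ext x; exact iteratedDeriv_comp_neg k f x
  rw [this]
  exact (hf.2 k hk).comp_neg.smul ((-1 : ℝ) ^ k)

theorem rightApproxOrder_iff (α : ℝ) (w : ℕ → ℝ) (r q : ℝ) (f : ℝ → ℝ) :
    RightApproxOrder α w r q f ↔ LeftApproxOrder α w r q fun x => f (-x) := by
  have h1 : ∀ x y : ℝ, -(-x - y) = x + y := fun x y => by ring
  have h2 : ∀ x L, HasRightGLDeriv α f x L ↔ HasLeftGLDeriv α (fun x => f (-x)) (-x) L := by
    intro x L
    simp only [HasRightGLDeriv, HasLeftGLDeriv, h1]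
  have h3 : ∀ h x, rightGrunwald α w r h f x = leftGrunwald α w r h (fun x => f (-x)) (-x) := by
    intro h x
    simp only [rightGrunwald, leftGrunwald, h1]
  rw [RightApproxOrder, LeftApproxOrder, (neg_surjective (G := ℝ)).forall (p := fun x => ∃ L, _)]
  have h4 : ∀ x y : ℝ, -(x - y) = -x + y := fun x y => by ring
  simp only [h2, h3, h4, neg_neg]

end

theorem mainTheorem4 (α : ℝ) (hα : 0 < α) (n : ℕ) (hn : (n : ℝ) - 1 < α) (hn' : α ≤ (n : ℝ))
    (p : ℕ) (hp : 1 ≤ p) (hp' : p ≤ 6) :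
    (∀ f : ℝ → ℝ, IntegrablySmooth (p + n + 1) f →
      LeftApproxOrder α (lubichWeight p α) 0 (p : ℝ) f ∧
        RightApproxOrder α (lubichWeight p α) 0 (p : ℝ) f) ∧
    (∀ r : ℝ, r ≠ 0 → ∀ f : ℝ → ℝ, IntegrablySmooth (1 + n + 1) f →
      (LeftApproxOrder α (lubichWeight p α) r 1 f ∧
        RightApproxOrder α (lubichWeight p α) r 1 f) ∧
      (¬ (p = 1 ∧ r = α / 2) → f ≠ 0 → ∀ q : ℝ, 1 < q →
        ¬ LeftApproxOrder α (lubichWeight p α) r q f ∧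
          ¬ RightApproxOrder α (lubichWeight p α) r q f)) := by
  refine ⟨fun f hf => ?_, fun r hr f hf => ⟨?_, fun hpr hf0 q hq => ?_⟩⟩
  · have hS := symbolExpansion_lubich_unshifted hα hp hp'
    rw [rightApproxOrder_iff]
    exact ⟨leftApproxOrder_of_symbolExpansion hα hn' hp hp' hp hf hS,
      leftApproxOrder_of_symbolExpansion hα hn' hp hp' hp hf.comp_neg hS⟩
  · have hS := (symbolExpansion_lubich_shifted hα hp hp' r).order_one
    rw [rightApproxOrder_iff]
    have h1 := leftApproxOrder_of_symbolExpansion hα hn' hp hp' le_rfl hf hS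
    have h2 := leftApproxOrder_of_symbolExpansion hα hn' hp hp' le_rfl hf.comp_neg hS
    rw [Nat.cast_one] at h1 h2
    exact ⟨h1, h2⟩
  · have hS := symbolExpansion_lubich_shifted hα hp hp' r
    -- A vanishing coefficient would mean r = α/2 when p = 1 and r = 0 when p ≥ 2, the two excluded
    -- cases.
    have hc : r + α * lubichSecond p ≠ 0 := by
      by_cases h1 : p = 1
      · simp only [lubichSecond, h1, if_true]
        intro h
        exact hpr ⟨h1, by linarith⟩
      · simpa [lubichSecond, h1] using hr
    have hf2 : IntegrablySmooth (n + 2) f := hf.mono (by omega)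
    have hf0' : (fun x => f (-x)) ≠ 0 := by
      intro h
      refine hf0 (funext fun x => ?_)
      simpa using congrFun h (-x)
    rw [rightApproxOrder_iff]
    exact ⟨not_leftApproxOrder_of_symbolExpansion hα hn' hp hp' hc hf2 hS hf0 hq,
      not_leftApproxOrder_of_symbolExpansion hα hn' hp hp' hc hf2.comp_neg hS hf0' hq⟩
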